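/- **Setting.** For a finite simple graph $G$ let $M_G$ be the group generated by a central element $\mathrm i$ with $\mathrm i^4=1$ (write $-1:=\mathrm i^2$), the vertices $v_j$ and the directed edges $e_{jk}$ of $G$, subject to $e_{jk}^2=v_j^2=1$, $e_{jk}=-e_{kj}$, $v_jv_k=v_kv_j$, $e_{jk}v_l=v_le_{jk}$ for $l\notin\{j,k\}$, $e_{jk}v_k=-v_ke_{jk}$, $e_{jk}e_{kl}=-e_{kl}e_{jk}$ for $j\ne l$, and $e_{jk}e_{lm}=e_{lm}e_{jk}$ for $\{j,k\}\cap\{l,m\}=\emptyset$. Let $\mathcal C_G\le M_G$ be the subgroup generated by the cycles $\mathrm i^{r}e_{j_1j_2}e_{j_2j_3}\cdots e_{j_rj_1}$ of all closed walks in $G$ with $r$ edges. Let $G$ be the cubic lattice with $n_1\times n_2\times n_3$ cells, $n_1,n_2,n_3\ge 1$: its vertices are the integer points of $\prod_k[0,n_k]$, its edges join points at distance $1$. Orient the edges so that in every two-dimensional axis-parallel slice the unit faces are alternately (in a checkerboard pattern) *even* (the four edges circulate around the face) and *odd* (edges of the face that meet at a vertex of it do so head to head or tail to tail). A cell is *odd*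 if all its six faces are odd. An *isolated odd face* is an odd face on the boundary of the lattice that is not a face of an odd cell. For each isolated odd face choose one of its four edges. Put one qubit on every vertex and one on every odd face. For an edge from $j$ to $k$ (in the orientation), in coordinate direction $x$, $y$ or $z$, let $\tilde e_{jk}=\pm X_jY_kP(j,k)$ and $\tilde e_{kj}=-\tilde e_{jk}$, where $P(j,k)$ is the product of the Pauli operators $X$, $Y$ or $Z$, respectively, on the qubits of all odd faces that contain the edge, and where the sign is $-$ if the edge has been chosen for an isolated odd face and $+$ otherwise. Let $\tilde v_j=Z_j$. **Lemma.** There is a (necessarily unique) representation $\sigma$ of $M_G$ on the Hilbert space of the qubits with $\sigma(\mathrm i)=\mathrm i\,\mathbb I$, $\sigma(v_j)=\tilde v_j$ and $\sigma(e_{jk})=\tilde e_{jk}$. Let $K=\ker(\sigma|_{\mathcal C_G})$ be the group of cycles mapped to the identity, and let $D(K)$ be its rank, i.e. the minimum size of a generating set. Then $K$ is finitely generated and $$D(K)=IOF+2\,OC,$$ where $IOF$ is the number of isolated odd faces and $OC$ the number of odd cells. Moreover, however one chooses two different pairs of opposite faces of each odd cell, the cycles around the isolated odd faces together with the products $ab$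 of the cycles $a,b$ around the two faces of each chosen pair generate $K$; these $IOF+2\,OC$ elements are pairwise distinct, and none of them lies in the subgroup generated by the others. -/

import Mathlib

/-! ### The group of edges and vertices of a graph, and its cycle subgroup -/

/-- Generators: the phase `i`, the vertices, and the directed edges `e_{ij}`. -/
inductive MGen {V : Type} (G : SimpleGraph V) : Type
  | phase : MGen G
  | vert (v : V) : MGen G
  | edge (d : G.Dart) : MGen G

namespace MGen

/-- The generator `i`, as a word. -/
def I {V : Type} (G : SimpleGraph V) : FreeGroup (MGen G) := FreeGroup.of phase

/-- A vertex, as a word. -/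
def v {V : Type} (G : SimpleGraph V) (x : V) : FreeGroup (MGen G) := FreeGroup.of (vert x)

/-- A directed edge, as a word. -/
def e {V : Type} (G : SimpleGraph V) (d : G.Dart) : FreeGroup (MGen G) := FreeGroup.of (edge d)

end MGen

open MGen in
/-- `MRel G a b`: the relation `a = b` is one of the defining relations of `M_G`.
The phases `±1, ±i` are the powers of the central element `I G`, so that `-1` is `I G ^ 2`. -/
inductive MRel {V : Type} (G : SimpleGraph V) : FreeGroup (MGen G) → FreeGroup (MGen G) → Prop
  | phase_order : MRel G (I G ^ 4) 1
  | phase_central (x : MGen G) : MRel G (I G * FreeGroup.of x) (FreeGroup.of x * I G)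
  | edge_sq (d : G.Dart) : MRel G (e G d ^ 2) 1
  | vert_sq (x : V) : MRel G (v G x ^ 2) 1
  | edge_symm (d : G.Dart) : MRel G (e G d) (I G ^ 2 * e G d.symm)
  | vert_vert (x y : V) : MRel G (v G x * v G y) (v G y * v G x)
  | edge_vert_comm (d : G.Dart) (x : V) (h₁ : x ≠ d.fst) (h₂ : x ≠ d.snd) :
      MRel G (e G d * v G x) (v G x * e G d)
  | edge_edge_comm (d d' : G.Dart) (h₁ : d.fst ≠ d'.fst) (h₂ : d.fst ≠ d'.snd)
      (h₃ : d.snd ≠ d'.fst) (h₄ : d.snd ≠ d'.snd) : MRel G (e G d * e G d') (e G d' * e G d)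
  | edge_vert_anti (d : G.Dart) : MRel G (e G d * v G d.snd) (I G ^ 2 * (v G d.snd * e G d))
  | edge_edge_anti (d d' : G.Dart) (h : d.snd = d'.fst) (h' : d.fst ≠ d'.snd) :
      MRel G (e G d * e G d') (I G ^ 2 * (e G d' * e G d))

/-- The finitely presented group `M_G`. -/
abbrev MGroup {V : Type} (G : SimpleGraph V) : Type :=
  PresentedGroup {r : FreeGroup (MGen G) | ∃ a b, MRel G a b ∧ r = a * b⁻¹}

namespace MGroup

variable {V : Type} (G : SimpleGraph V)

/-- The phase `i` in `M_G`. -/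
def I : MGroup G := PresentedGroup.of MGen.phase

/-- The element of `M_G` given by a vertex. -/
def vert (x : V) : MGroup G := PresentedGroup.of (MGen.vert x)

/-- The element of `M_G` given by a directed edge. -/
def edge (d : G.Dart) : MGroup G := PresentedGroup.of (MGen.edge d)

/-- The element `i ^ (number of edges) * ∏ e` attached to a walk. -/
def ofWalk {x y : V} (p : G.Walk x y) : MGroup G :=
  I G ^ p.length * (p.darts.map (edge G)).prod

/-- The group of directed cycles `C_G`. -/
def cycles : Subgroup (MGroup G) :=
  Subgroup.closure {a | ∃ (x : V) (p : G.Walk x x), a = ofWalk G p}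

/-- `K = ker (σ|_{C_G})`, the group of all cycles that are mapped to the identity. -/
def cycleKernel {A : Type} [Monoid A] (σ : MGroup G →* A) : Subgroup (MGroup G) :=
  cycles G ⊓ σ.ker

end MGroup

/-! ### Pauli operators on a finite set of qubits -/

namespace Pauli

/-- The Pauli matrices `X`, `Y`, `Z`, indexed by `0`, `1`, `2`. -/
def mat : Fin 3 → Matrix (Fin 2) (Fin 2) ℂ :=
  ![!![0, 1; 1, 0], !![0, -Complex.I; Complex.I, 0], !![1, 0; 0, -1]]

/-- The operator `⨂_q P_q` on the Hilbert space `⨂_q ℂ²`, as a matrix in the computational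
basis. -/
def tensor {Q : Type} [Fintype Q] (P : Q → Matrix (Fin 2) (Fin 2) ℂ) :
    Matrix (Q → Fin 2) (Q → Fin 2) ℂ :=
  Matrix.of fun a b => ∏ q, P q (a q) (b q)

end Pauli

/-! ### The cubic lattice with `n 0 × n 1 × n 2` cells -/

namespace Cubic

/-- Vertices of the lattice: integer points of the box `∏ [0, n k]`. -/
abbrev Vertex (n : Fin 3 → ℕ) : Type := (k : Fin 3) → Fin (n k + 1)

variable {n : Fin 3 → ℕ}

/-- `w` is the neighbour of `v` in the positive `k`-direction. -/
def IsNext (k : Fin 3) (v w : Vertex n) : Prop :=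
  (w k : ℕ) = v k + 1 ∧ ∀ l, l ≠ k → w l = v l

instance (k : Fin 3) (v w : Vertex n) : Decidable (IsNext k v w) :=
  inferInstanceAs (Decidable (_ ∧ _))

/-- The graph of the cubic lattice. -/
def graph (n : Fin 3 → ℕ) : SimpleGraph (Vertex n) where
  Adj v w := ∃ k, IsNext k v w ∨ IsNext k w v
  symm := ⟨fun _ _ ⟨k, h⟩ => ⟨k, h.symm⟩⟩
  loopless := ⟨fun v ⟨k, h⟩ => by
    rcases h with h | h <;> exact absurd h.1 (by omega)⟩

instance : DecidableRel (graph n).Adj := fun v w =>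
  inferInstanceAs (Decidable (∃ k, IsNext k v w ∨ IsNext k w v))

/-- The neighbour of `v` in the positive `k`-direction. -/
def up (v : Vertex n) (k : Fin 3) (h : (v k : ℕ) < n k) : Vertex n :=
  Function.update v k ⟨v k + 1, by omega⟩

/-- The direction of the edge between adjacent vertices `v` and `w`. -/
def dir (v w : Vertex n) : Fin 3 := if v 0 ≠ w 0 then 0 else if v 1 ≠ w 1 then 1 else 2

/-- A square face: its normal direction `axis` and its vertex `corner` with the smallest
coordinates. -/
@[ext]
structure Face (n : Fin 3 → ℕ) : Type where
  axis : Fin 3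
  corner : Vertex n
  lt : ∀ k, k ≠ axis → (corner k : ℕ) < n k
  deriving DecidableEq

/-- The faces form a finite type. -/
def Face.equiv (n : Fin 3 → ℕ) :
    {p : Fin 3 × Vertex n // ∀ k, k ≠ p.1 → (p.2 k : ℕ) < n k} ≃ Face n where
  toFun p := ⟨p.1.1, p.1.2, p.2⟩
  invFun f := ⟨(f.axis, f.corner), f.lt⟩
  left_inv _ := rfl
  right_inv _ := rfl

instance : Fintype (Face n) := Fintype.ofEquiv _ (Face.equiv n)

/-- `w` is one of the four vertices of the face `f`. -/
def Face.HasVertex (f : Face n) (w : Vertex n) : Prop :=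
  w f.axis = f.corner f.axis ∧
    ∀ k, k ≠ f.axis → (w k : ℕ) = f.corner k ∨ (w k : ℕ) = f.corner k + 1

instance (f : Face n) (w : Vertex n) : Decidable (f.HasVertex w) :=
  inferInstanceAs (Decidable (_ ∧ _))

/-- A face on the boundary of the lattice. -/
def Face.IsBoundary (f : Face n) : Prop :=
  (f.corner f.axis : ℕ) = 0 ∨ (f.corner f.axis : ℕ) = n f.axis

instance (f : Face n) : Decidable f.IsBoundary := inferInstanceAs (Decidable (_ ∨ _))

/-- Two different faces that lie in a common two-dimensional slice and share an edge. -/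
def Face.AdjInSlice (f g : Face n) : Prop :=
  f.axis = g.axis ∧ ∃ k, k ≠ f.axis ∧ (IsNext k f.corner g.corner ∨ IsNext k g.corner f.corner)

/-- The closed walk around a face. -/
def Face.walk (f : Face n) : (graph n).Walk f.corner f.corner :=
  have ha : f.axis + 1 ≠ f.axis := by simp
  have hb : f.axis + 2 ≠ f.axis := by simp
  have hab : f.axis + 2 ≠ f.axis + 1 := by simp
  have h₁ := f.lt _ ha
  have h₂ := f.lt _ hb
  have h₃ : (up f.corner (f.axis + 1) h₁ (f.axis + 2) : ℕ) < n (f.axis + 2) := by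
    simpa [up, Function.update_of_ne hab] using h₂
  .cons (v := up f.corner (f.axis + 1) h₁)
    ⟨f.axis + 1, .inl ⟨by simp [up], fun l hl => by simp [up, Function.update_of_ne hl]⟩⟩ <|
  .cons (v := up (up f.corner (f.axis + 1) h₁) (f.axis + 2) h₃)
    ⟨f.axis + 2, .inl ⟨by simp [up], fun l hl => by simp [up, Function.update_of_ne hl]⟩⟩ <|
  .cons (v := up f.corner (f.axis + 2) h₂)
    ⟨f.axis + 1, .inr ⟨by simp [up], fun l hl => by
      by_cases h : l = f.axis + 2
      · subst h; simp [up]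
      · simp [up, Function.update_of_ne h, Function.update_of_ne hl]⟩⟩ <|
  .cons
    ⟨f.axis + 2, .inr ⟨by simp [up], fun l hl => by simp [up, Function.update_of_ne hl]⟩⟩ .nil

/-- The cycle around a face, as an element of `M_G`. -/
def faceCycle (f : Face n) : MGroup (graph n) := MGroup.ofWalk (graph n) f.walk

/-- Cubic cells, given by their vertex with the smallest coordinates. -/
abbrev Cell (n : Fin 3 → ℕ) : Type := (k : Fin 3) → Fin (n k)

/-- The face of the cell `c` with normal direction `k` and smaller `k`-coordinate. -/
def Cell.lower (c : Cell n) (k : Fin 3) : Face n where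
  axis := k
  corner l := (c l).castSucc
  lt l _ := (c l).isLt

/-- The face of the cell `c` opposite to `c.lower k`. -/
def Cell.upper (c : Cell n) (k : Fin 3) : Face n where
  axis := k
  corner := Function.update (fun l => (c l).castSucc) k (c k).succ
  lt l h := by simp [Function.update_of_ne h]

/-- `f` is one of the six faces of `c`. -/
def Face.IsFaceOf (f : Face n) (c : Cell n) : Prop := ∃ k, f = c.lower k ∨ f = c.upper k

instance (f : Face n) (c : Cell n) : Decidable (f.IsFaceOf c) :=
  inferInstanceAs (Decidable (∃ _, _))

/-- The cycle around the pair of opposite faces of `c` with normal direction `k`. -/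
def pairCycle (c : Cell n) (k : Fin 3) : MGroup (graph n) :=
  faceCycle (c.lower k) * faceCycle (c.upper k)

/-- The edges around `f` circulate: at each vertex of `f` one of the two edges of `f` points in
and the other one points out. Here `o v w` says that the edge between `v` and `w` points
from `v` to `w`. -/
def IsEvenFace (o : Vertex n → Vertex n → Bool) (f : Face n) : Prop :=
  ∀ u v w, f.HasVertex u → f.HasVertex v → f.HasVertex w →
    (graph n).Adj u v → (graph n).Adj v w → u ≠ w → o u v = o v w

/-- The edges around `f` touch head to head or tail to tail. -/
def IsOddFace (o : Vertex n → Vertex n → Bool) (f : Face n) : Prop :=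
  ∀ u v w, f.HasVertex u → f.HasVertex v → f.HasVertex w →
    (graph n).Adj u v → (graph n).Adj v w → u ≠ w → o u v = o w v

instance (o : Vertex n → Vertex n → Bool) (f : Face n) : Decidable (IsOddFace o f) :=
  inferInstanceAs (Decidable (∀ _, _))

/-- An orientation of the edges of the cubic lattice all of whose two-dimensional slices are
oriented as in the square lattice encoding: the faces of each slice are even or odd in a
checkerboard pattern. -/
structure Orientation (n : Fin 3 → ℕ) : Type where
  /-- For adjacent `v` and `w`, the edge between them points from `v` to `w`. -/
  pointsTo : Vertex n → Vertex n → Bool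
  pointsTo_symm : ∀ v w, (graph n).Adj v w → pointsTo w v = !pointsTo v w
  even_or_odd : ∀ f : Face n, IsEvenFace pointsTo f ∨ IsOddFace pointsTo f
  checkerboard : ∀ f g : Face n, f.AdjInSlice g →
    (IsOddFace pointsTo f ↔ IsEvenFace pointsTo g)

/-- Odd cells: all six faces are odd. -/
def IsOddCell (o : Orientation n) (c : Cell n) : Prop :=
  ∀ f : Face n, f.IsFaceOf c → IsOddFace o.pointsTo f

instance (o : Orientation n) (c : Cell n) : Decidable (IsOddCell o c) :=
  inferInstanceAs (Decidable (∀ _, _))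

/-- Isolated odd faces: odd faces on the boundary that are not faces of an odd cell. -/
def IsIsolatedOddFace (o : Orientation n) (f : Face n) : Prop :=
  IsOddFace o.pointsTo f ∧ f.IsBoundary ∧ ∀ c : Cell n, IsOddCell o c → ¬ f.IsFaceOf c

instance (o : Orientation n) (f : Face n) : Decidable (IsIsolatedOddFace o f) :=
  inferInstanceAs (Decidable (_ ∧ _))

/-- The type of odd faces. -/
abbrev OddFace (o : Orientation n) : Type := {f : Face n // IsOddFace o.pointsTo f}

/-- The type of isolated odd faces. -/
abbrev IsolatedOddFace (o : Orientation n) : Type := {f : Face n // IsIsolatedOddFace o f}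

/-- The type of odd cells. -/
abbrev OddCell (o : Orientation n) : Type := {c : Cell n // IsOddCell o c}

/-- A choice, for every isolated odd face, of an edge of that face; the edge is recorded with
its direction in the orientation `o`. -/
structure EdgeChoice (o : Orientation n) : Type where
  edge : IsolatedOddFace o → (graph n).Dart
  pointsTo : ∀ f, o.pointsTo (edge f).fst (edge f).snd = true
  mem : ∀ f : IsolatedOddFace o, f.1.HasVertex (edge f).fst ∧ f.1.HasVertex (edge f).snd

/-! ### The cubic encoding -/

/-- There is one qubit for every vertex and one for every odd face. -/
abbrev Qubit (o : Orientation n) : Type := Vertex n ⊕ OddFace o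

/-- Operators on the Hilbert space of the qubits. -/
abbrev Op (o : Orientation n) : Type := Matrix (Qubit o → Fin 2) (Qubit o → Fin 2) ℂ

/-- The encoded vertex operator `Z_v`. -/
def vertexOp (o : Orientation n) (v : Vertex n) : Op o :=
  Pauli.tensor fun q => if q = .inl v then Pauli.mat 2 else 1

/-- The operator `X_v Y_w P(v, w)`, where `P(v, w)` acts with the Pauli matrix `X`, `Y` or `Z`,
according to the direction of the edge, on every odd face that the edge bounds. -/
def rawEdgeOp (o : Orientation n) (v w : Vertex n) : Op o :=
  Pauli.tensor fun q => match q with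
    | .inl u => if u = v then Pauli.mat 0 else if u = w then Pauli.mat 1 else 1
    | .inr f => if f.1.HasVertex v ∧ f.1.HasVertex w then Pauli.mat (dir v w) else 1

open Classical in
/-- The encoded operator of an edge that points from `d.fst` to `d.snd`; the sign is `-1` for
the edges that were chosen for the isolated odd faces. -/
noncomputable def forwardOp (o : Orientation n) (χ : EdgeChoice o) (d : (graph n).Dart) : Op o :=
  if ∃ f, χ.edge f = d then -rawEdgeOp o d.fst d.snd else rawEdgeOp o d.fst d.snd

/-- The encoded operator of a directed edge. -/
noncomputable def edgeOp (o : Orientation n) (χ : EdgeChoice o) (d : (graph n).Dart) : Op o :=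
  if o.pointsTo d.fst d.snd then forwardOp o χ d else -forwardOp o χ d.symm

/-- `σ` is the cubic encoding: the representation of `M_G` given by the above operators. It is
determined by these values, since they are prescribed on generators of `M_G`. -/
structure IsEncoding (o : Orientation n) (χ : EdgeChoice o) (σ : MGroup (graph n) →* Op o) :
    Prop where
  phase : σ (MGroup.I (graph n)) = Complex.I • (1 : Op o)
  vert : ∀ v, σ (MGroup.vert (graph n) v) = vertexOp o v
  edge : ∀ d, σ (MGroup.edge (graph n) d) = edgeOp o χ d

/-- The cycles around all isolated odd faces, and around the two pairs of opposite faces with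
normal directions `p c` and `q c` for every odd cell `c`. -/
def kernelGen (o : Orientation n) (p q : OddCell o → Fin 3) :
    IsolatedOddFace o ⊕ (OddCell o ⊕ OddCell o) → MGroup (graph n)
  | .inl f => faceCycle f.1
  | .inr (.inl c) => pairCycle c.1 (p c)
  | .inr (.inr c) => pairCycle c.1 (q c)

end Cubic

/-! Counting occurrences of vertices and edges modulo 2 is a homomorphism on `M_G` whose kernel
consists of the phases, since modulo phases the group is abelian and generated by involutions. As σ
is faithful on phases, an element of `K` is determined by the set of edges it contains an odd number
of times (`content_injOn_ker`), so `K` behaves like a space of edge sets over 𝔽₂.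

The checkerboard condition is rigid. Straight lines are oriented consistently and parallel sides of
a square point opposite ways, so there are shifts `a k` such that a face is odd iff its two in-plane
corner coordinates, shifted by `a`, have equal parity (`exists_isParity`), and a cell is odd iff all
three have. Hence every odd face is isolated or belongs to exactly one odd cell, and isolated odd
faces and odd cells are pairwise edge-disjoint.

The cycle around an odd face acts as -1 on its own qubit and trivially on vertices. For an isolated
face no other qubit is touched and the chosen edge corrects the sign (`map_faceCycle_of_isolated`).
For opposite faces of an odd cell the two signs cancel, and each side face receives the same Pauli
matrix twice (`map_pairCycle`).

Conversely, the identity commutes with every single-qubit Pauli operator, so an element of `K`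
contains an even number of edges anticommuting with it (`exists_edge_of_test`). Tests on face qubits
show that parallel edges of an odd face, hence of an odd cell, occur together. Tests on vertex
qubits show that each edge meets a perpendicular one in an odd face. So every edge lies on a basic
cycle contained in the element, and multiplying such cycles away ends at 1 (`closure_basicCycle`).

Each edge of an odd cell lies in two of the three pairs, so one pair is redundant. Edges detecting
the remaining generators give dual functionals (`edgeHom_dualDart`), whence independence and the
rank. -/

/-! ### Homomorphisms out of `M_G` -/

namespace MGroup

variable {V : Type} {G : SimpleGraph V}

/-- The homomorphism out of `M_G` given by values on the generators that satisfy the relations. -/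
def lift {H : Type} [Group H] (f : MGen G → H)
    (hf : ∀ a b, MRel G a b → FreeGroup.lift f a = FreeGroup.lift f b) : MGroup G →* H :=
  PresentedGroup.toGroup (f := f) (by
    rintro r ⟨a, b, hab, rfl⟩
    rw [map_mul, map_inv, hf a b hab, mul_inv_cancel])

theorem lift_of {H : Type} [Group H] (f : MGen G → H)
    (hf : ∀ a b, MRel G a b → FreeGroup.lift f a = FreeGroup.lift f b) (x : MGen G) :
    lift f hf (PresentedGroup.of x) = f x :=
  PresentedGroup.toGroup.of _

theorem mk_eq_of_rel {a b : FreeGroup (MGen G)} (h : MRel G a b) :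
    PresentedGroup.mk {r : FreeGroup (MGen G) | ∃ a b, MRel G a b ∧ r = a * b⁻¹} a =
      PresentedGroup.mk _ b :=
  PresentedGroup.mk_eq_mk_of_mul_inv_mem ⟨a, b, h, rfl⟩

theorem I_pow_four : I G ^ 4 = 1 := by
  have h := mk_eq_of_rel (MRel.phase_order (G := G))
  rwa [map_pow, map_one] at h

theorem I_mul_of (x : MGen G) :
    I G * PresentedGroup.of x = PresentedGroup.of x * I G := by
  have h := mk_eq_of_rel (MRel.phase_central x)
  rwa [map_mul, map_mul] at h

theorem vert_sq (x : V) : vert G x ^ 2 = 1 := by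
  have h := mk_eq_of_rel (MRel.vert_sq (G := G) x)
  rwa [map_pow, map_one] at h

theorem edge_sq (d : G.Dart) : edge G d ^ 2 = 1 := by
  have h := mk_eq_of_rel (MRel.edge_sq d)
  rwa [map_pow, map_one] at h

theorem edge_symm (d : G.Dart) : edge G d = I G ^ 2 * edge G d.symm := by
  have h := mk_eq_of_rel (MRel.edge_symm d)
  rwa [map_mul, map_pow] at h

theorem vert_mul_vert (x y : V) : vert G x * vert G y = vert G y * vert G x := by
  have h := mk_eq_of_rel (MRel.vert_vert (G := G) x y)
  rwa [map_mul, map_mul] at h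

theorem edge_mul_vert {d : G.Dart} {x : V} (h₁ : x ≠ d.fst) (h₂ : x ≠ d.snd) :
    edge G d * vert G x = vert G x * edge G d := by
  have h := mk_eq_of_rel (MRel.edge_vert_comm d x h₁ h₂)
  rwa [map_mul, map_mul] at h

theorem edge_mul_edge {d d' : G.Dart} (h₁ : d.fst ≠ d'.fst) (h₂ : d.fst ≠ d'.snd)
    (h₃ : d.snd ≠ d'.fst) (h₄ : d.snd ≠ d'.snd) :
    edge G d * edge G d' = edge G d' * edge G d := by
  have h := mk_eq_of_rel (MRel.edge_edge_comm d d' h₁ h₂ h₃ h₄)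
  rwa [map_mul, map_mul] at h

theorem edge_mul_vert_snd (d : G.Dart) :
    edge G d * vert G d.snd = I G ^ 2 * (vert G d.snd * edge G d) := by
  have h := mk_eq_of_rel (MRel.edge_vert_anti d)
  rwa [map_mul, map_mul, map_pow, map_mul] at h

theorem edge_mul_edge_of_snd_eq {d d' : G.Dart} (h : d.snd = d'.fst) (h' : d.fst ≠ d'.snd) :
    edge G d * edge G d' = I G ^ 2 * (edge G d' * edge G d) := by
  have h := mk_eq_of_rel (MRel.edge_edge_anti d d' h h')
  rwa [map_mul, map_mul, map_pow, map_mul] at h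

/-- Induction over the elements of `M_G`, starting from the generators. -/
theorem induction {P : MGroup G → Prop} (of : ∀ x : MGen G, P (PresentedGroup.of x)) (one : P 1)
    (mul : ∀ a b, P a → P b → P (a * b)) (inv : ∀ a, P a → P a⁻¹) (m : MGroup G) : P m := by
  have hm : m ∈ Subgroup.closure (Set.range (PresentedGroup.of
      (rels := {r : FreeGroup (MGen G) | ∃ a b, MRel G a b ∧ r = a * b⁻¹}))) := by
    rw [PresentedGroup.closure_range_of]; trivial
  induction hm using Subgroup.closure_induction with
  | mem x hx => obtain ⟨y, rfl⟩ := hx; exact of y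
  | one => exact one
  | mul x y _ _ hx hy => exact mul x y hx hy
  | inv x _ hx => exact inv x hx

theorem I_mem_center (m : MGroup G) : I G * m = m * I G :=
  induction (P := fun m => I G * m = m * I G) I_mul_of (by simp)
    (fun a b ha hb => by rw [← mul_assoc, ha, mul_assoc, hb, mul_assoc])
    (fun a ha => ((show Commute (I G) a from ha).inv_right).eq) m

instance normal_zpowers_I : (Subgroup.zpowers (I G)).Normal where
  conj_mem x hx g := by
    obtain ⟨k, rfl⟩ := hx
    have : Commute (I G ^ k) g := (show Commute (I G) g from I_mem_center g).zpow_left k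
    rw [show g * I G ^ k = I G ^ k * g from this.eq.symm, mul_inv_cancel_right]
    exact ⟨k, rfl⟩

/-! ### The number of occurrences of the generators, modulo two -/

open Classical in
/-- The generator counted modulo two; phases are not counted. -/
noncomputable def genContent : MGen G → (V ⊕ G.edgeSet → ZMod 2)
  | .phase => 0
  | .vert x => Pi.single (.inl x) 1
  | .edge d => Pi.single (.inr ⟨d.edge, d.edge_mem⟩) 1

/-- How often the vertices and the edges occur in an element of `M_G`, modulo two, as a
homomorphism. -/
noncomputable def contentHom (G : SimpleGraph V) :
    MGroup G →* Multiplicative (V ⊕ G.edgeSet → ZMod 2) :=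
  lift (fun x => .ofAdd (genContent x)) (by
    have sq (x : V ⊕ G.edgeSet → ZMod 2) :
        (Multiplicative.ofAdd x) ^ 2 = (1 : Multiplicative (V ⊕ G.edgeSet → ZMod 2)) := by
      rw [pow_two, ← ofAdd_add]
      exact congrArg _ (funext fun b => CharTwo.add_self_eq_zero _)
    have key (d : G.Dart) : genContent (.edge d.symm) = genContent (.edge d) := by
      simp [genContent]
    intro a b h
    cases h <;>
      simp only [MGen.I, MGen.v, MGen.e, map_mul, map_pow, FreeGroup.lift_apply_of, map_one, sq,
        one_mul, key] <;> first | exact mul_comm _ _ | skip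
    rw [show 4 = 2 * 2 from rfl, pow_mul, sq, one_pow])

/-- How often the vertices and the edges occur in an element of `M_G`, modulo two. -/
noncomputable def content (m : MGroup G) : V ⊕ G.edgeSet → ZMod 2 := (contentHom G m).toAdd

theorem content_of (x : MGen G) :
    content (PresentedGroup.of x : MGroup G) = genContent x := by
  rw [content, contentHom, lift_of]; rfl

theorem content_mul (a b : MGroup G) : content (a * b) = content a + content b := by
  rw [content, map_mul]; rfl

theorem content_one : content (1 : MGroup G) = 0 := by
  rw [content, map_one]; rfl

theorem content_inv (a : MGroup G) : content a⁻¹ = content a := by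
  rw [content, map_inv]
  exact funext fun b => CharTwo.neg_eq _

theorem content_I_pow (k : ℕ) : content (I G ^ k) = 0 := by
  induction k with
  | zero => rw [pow_zero, content_one]
  | succ k ih => rw [pow_succ, content_mul, ih, I, content_of]; simp [genContent]

/-- The number of occurrences of an edge, modulo two. -/
noncomputable def edgeContent (m : MGroup G) (d : G.Dart) : ZMod 2 :=
  content m (.inr ⟨d.edge, d.edge_mem⟩)

theorem edgeContent_congr (m : MGroup G) {d d' : G.Dart} (h : d.edge = d'.edge) :
    edgeContent m d = edgeContent m d' := by
  unfold edgeContent; congr 3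

theorem edgeContent_mul (a b : MGroup G) (d : G.Dart) :
    edgeContent (a * b) d = edgeContent a d + edgeContent b d := by
  simp [edgeContent, content_mul]

open Classical in
theorem edgeContent_edge (d d' : G.Dart) :
    edgeContent (edge G d) d' = if d.edge = d'.edge then 1 else 0 := by
  rw [edgeContent, edge, content_of]
  simp [genContent, Pi.single_apply, eq_comm]

/-- Closed walks multiply only phases and edges. Parity counts on the cycle group therefore involve
edges alone, even where a test operator also anticommutes with a vertex. -/
theorem content_inl_of_mem_cycles {m : MGroup G} (hm : m ∈ cycles G) (x : V) :
    content m (.inl x) = 0 := by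
  have edges (l : List G.Dart) : content ((l.map (edge G)).prod) (.inl x) = 0 := by
    induction l with
    | nil => simp [content_one]
    | cons d l ih =>
      rw [List.map_cons, List.prod_cons, content_mul, Pi.add_apply, ih, edge, content_of]
      simp [genContent]
  induction hm using Subgroup.closure_induction with
  | mem a ha =>
    obtain ⟨y, p, rfl⟩ := ha
    rw [ofWalk, content_mul, Pi.add_apply, content_I_pow, edges]; simp
  | one => simp [content_one]
  | mul a b _ _ ha hb => rw [content_mul, Pi.add_apply, ha, hb, add_zero]
  | inv a _ ha => rw [content_inv, ha]

/-! ### Elements without content are phases -/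

/-- Killing the phase turns every anticommutation relation into commutation. An edge and its reverse
become equal, so all ways of sharing an endpoint reduce to the head-to-tail case. -/
theorem quotient_I_mul_comm (x y : MGroup G ⧸ Subgroup.zpowers (I G)) : x * y = y * x := by
  let π := QuotientGroup.mk' (Subgroup.zpowers (I G))
  have hI : π (I G) = 1 :=
    (QuotientGroup.eq_one_iff _).2 (Subgroup.mem_zpowers _)
  have symm (d : G.Dart) : π (edge G d) = π (edge G d.symm) := by
    rw [edge_symm d, map_mul, map_pow, hI, one_pow, one_mul]
  have chain (d d' : G.Dart) (h : d.snd = d'.fst) :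
      Commute (π (edge G d)) (π (edge G d')) := by
    by_cases h' : d.fst = d'.snd
    · have : d' = d.symm := by
        apply SimpleGraph.Dart.ext
        exact Prod.ext h.symm h'.symm
      rw [this, ← symm]
    · have := congrArg π (edge_mul_edge_of_snd_eq h h')
      simpa [hI, Commute, SemiconjBy] using this
  have edges (d d' : G.Dart) : Commute (π (edge G d)) (π (edge G d')) := by
    by_cases h₁ : d.snd = d'.fst
    · exact chain d d' h₁
    by_cases h₂ : d.snd = d'.snd
    · rw [symm d']; exact chain d d'.symm h₂
    by_cases h₃ : d.fst = d'.fst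
    · rw [symm d]; exact chain d.symm d' h₃
    by_cases h₄ : d.fst = d'.snd
    · rw [symm d, symm d']; exact chain d.symm d'.symm h₄
    have := congrArg π (edge_mul_edge h₃ h₄ h₁ h₂)
    simpa [Commute, SemiconjBy] using this
  have snd (d : G.Dart) : Commute (π (edge G d)) (π (vert G d.snd)) := by
    have := congrArg π (edge_mul_vert_snd d)
    simpa [hI, Commute, SemiconjBy] using this
  have edgeVert (d : G.Dart) (x : V) : Commute (π (edge G d)) (π (vert G x)) := by
    by_cases h₁ : x = d.snd
    · rw [h₁]; exact snd d
    by_cases h₂ : x = d.fst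
    · rw [h₂, symm d]; exact snd d.symm
    have := congrArg π (edge_mul_vert h₂ h₁)
    simpa [Commute, SemiconjBy] using this
  have gens (a b : MGen G) :
      Commute (π (PresentedGroup.of a)) (π (PresentedGroup.of b)) := by
    match a, b with
    | .phase, _ => rw [show π (PresentedGroup.of MGen.phase) = 1 from hI]; exact Commute.one_left _
    | _, .phase => rw [show π (PresentedGroup.of MGen.phase) = 1 from hI]; exact Commute.one_right _
    | .vert x, .vert y =>
      have := congrArg π (vert_mul_vert (G := G) x y)
      rw [map_mul, map_mul] at this
      exact this
    | .vert x, .edge d => exact (edgeVert d x).symm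
    | .edge d, .vert x => exact edgeVert d x
    | .edge d, .edge d' => exact edges d d'
  obtain ⟨x, rfl⟩ := QuotientGroup.mk'_surjective _ x
  obtain ⟨y, rfl⟩ := QuotientGroup.mk'_surjective _ y
  change Commute (π x) (π y)
  refine induction (P := fun x => Commute (π x) (π y)) (fun a => ?_) ?_ ?_ ?_ x
  · refine induction (P := fun y => Commute (π (PresentedGroup.of a)) (π y)) (gens a) ?_ ?_ ?_ y
    · rw [map_one]; exact Commute.one_right _
    · intro b c hb hc; rw [map_mul]; exact hb.mul_right hc
    · intro b hb; rw [map_inv]; exact hb.inv_right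
  · rw [map_one]; exact Commute.one_left _
  · intro b c hb hc; rw [map_mul]; exact hb.mul_left hc
  · intro b hb; rw [map_inv]; exact hb.inv_left

/-- The quotient by the phases is abelian and generated by involutions, so the quotient map factors
through the content; trivial content then means trivial class. -/
theorem mem_zpowers_I_of_content_eq_zero [Finite V] {m : MGroup G} (hm : content m = 0) :
    m ∈ Subgroup.zpowers (I G) := by
  classical
  let _ : CommGroup (MGroup G ⧸ Subgroup.zpowers (I G)) :=
    { (inferInstance : Group (MGroup G ⧸ Subgroup.zpowers (I G))) with
      mul_comm := quotient_I_mul_comm }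
  have : Fintype (V ⊕ G.edgeSet) := Fintype.ofFinite _
  let π : MGroup G →* (MGroup G ⧸ Subgroup.zpowers (I G)) :=
    QuotientGroup.mk' (Subgroup.zpowers (I G))
  have hI : π (I G) = 1 := (QuotientGroup.eq_one_iff _).2 (Subgroup.mem_zpowers _)
  have symm (d : G.Dart) : π (edge G d) = π (edge G d.symm) := by
    rw [edge_symm d, map_mul, map_pow, hI, one_pow, one_mul]
  have exist (e : G.edgeSet) : ∃ d : G.Dart, d.edge = e := by
    obtain ⟨e, he⟩ := e
    induction e with
    | h x y => exact ⟨⟨(x, y), he⟩, rfl⟩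
  choose dart hdart using exist
  let t : V ⊕ G.edgeSet → (MGroup G ⧸ Subgroup.zpowers (I G)) :=
    Sum.elim (fun x => π (vert G x)) (fun e => π (edge G (dart e)))
  have ht (b) : t b ^ 2 = 1 := by
    rcases b with x | e
    · change π _ ^ 2 = 1; rw [← map_pow, vert_sq, map_one]
    · change π _ ^ 2 = 1; rw [← map_pow, edge_sq, map_one]
  -- Exponents modulo 2 suffice because each `t b` squares to 1; this is what makes `N`
  -- multiplicative.
  let N : Multiplicative (V ⊕ G.edgeSet → ZMod 2) →* (MGroup G ⧸ Subgroup.zpowers (I G)) :=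
    { toFun := fun x => ∏ b, t b ^ (x.toAdd b).val
      map_one' := by simp
      map_mul' := fun x y => by
        rw [← Finset.prod_mul_distrib]
        refine Finset.prod_congr rfl fun b _ => ?_
        rw [toAdd_mul, Pi.add_apply, ZMod.val_add, ← pow_add, eq_comm]
        exact pow_eq_pow_mod _ (ht b) }
  have hsingle (b) : N (.ofAdd (Pi.single b 1)) = t b := by
    change ∏ c, t c ^ ((Pi.single b 1 : V ⊕ G.edgeSet → ZMod 2) c).val = t b
    rw [Finset.prod_eq_single b]
    · simp [ZMod.val_one]
    · intro c _ hc; simp [Pi.single_eq_of_ne hc]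
    · simp
  have h : N.comp (contentHom G) = π := by
    refine PresentedGroup.ext fun x => ?_
    rw [MonoidHom.comp_apply, contentHom, lift_of]
    cases x with
    | phase => exact (map_one N).trans hI.symm
    | vert x => exact hsingle _
    | edge d =>
      refine (hsingle _).trans ?_
      change π (edge G (dart ⟨d.edge, d.edge_mem⟩)) = π (edge G d)
      rcases (SimpleGraph.dart_edge_eq_iff _ _).1 (hdart ⟨d.edge, d.edge_mem⟩) with h | h
      · rw [h]
      · rw [h, ← symm]
  have h1 : π m = 1 := by
    rw [← h, MonoidHom.comp_apply, show contentHom G m = 1 from hm, map_one]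
  exact (QuotientGroup.eq_one_iff _).1 h1

/-- Such an element is a phase, its exponent may be reduced modulo 4, and `hI` says that σ is
faithful on the four phases. -/
theorem eq_one_of_content_eq_zero [Finite V] {A : Type} [Monoid A] {σ : MGroup G →* A}
    (hI : ∀ k < 4, σ (I G) ^ k = 1 → k = 0) {m : MGroup G} (hm : content m = 0)
    (hσ : σ m = 1) : m = 1 := by
  obtain ⟨k, rfl⟩ := mem_zpowers_I_of_content_eq_zero hm
  have hmod : I G ^ k = I G ^ (k % 4).toNat := by
    rw [← zpow_natCast, Int.toNat_of_nonneg (by omega)]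
    conv_lhs => rw [← Int.mul_ediv_add_emod k 4, zpow_add, zpow_mul]
    rw [show I G ^ (4 : ℤ) = 1 from by exact_mod_cast I_pow_four (G := G), one_zpow, one_mul]
  simp only [hmod] at hσ ⊢
  rw [map_pow] at hσ
  rw [hI _ (by omega) hσ, pow_zero]

/-- Apply the previous result to `a * b⁻¹`, whose content is the sum of two equal vectors modulo 2.
Identities in the kernel thereby reduce to counting edges. -/
theorem content_injOn_ker [Finite V] {A : Type} [Monoid A] {σ : MGroup G →* A}
    (hI : ∀ k < 4, σ (I G) ^ k = 1 → k = 0) {a b : MGroup G} (ha : σ a = 1) (hb : σ b = 1)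
    (h : content a = content b) : a = b := by
  have hb' : σ b⁻¹ = 1 := by
    have := map_mul σ b b⁻¹
    rwa [mul_inv_cancel, map_one, hb, one_mul, eq_comm] at this
  refine mul_inv_eq_one.1 (eq_one_of_content_eq_zero hI ?_ (by rw [map_mul, ha, hb', one_mul]))
  rw [content_mul, content_inv, h]
  exact funext fun b => CharTwo.add_self_eq_zero _

/-! ### Test operators -/

/-- If the generators commute or anticommute with `T`, then an element of `M_G` does so according
to its content. -/
theorem map_mul_test {A : Type} [Ring A] (σ : MGroup G →* A) (T : A)
    (S : Finset (V ⊕ G.edgeSet)) (hI : σ (I G) * T = T * σ (I G))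
    (hv : ∀ x, (.inl x ∉ S → σ (vert G x) * T = T * σ (vert G x)) ∧
      (.inl x ∈ S → σ (vert G x) * T = -(T * σ (vert G x))))
    (he : ∀ d, (.inr ⟨d.edge, d.edge_mem⟩ ∉ S → σ (edge G d) * T = T * σ (edge G d)) ∧
      (.inr ⟨d.edge, d.edge_mem⟩ ∈ S → σ (edge G d) * T = -(T * σ (edge G d)))) (m : MGroup G) :
    ((∑ b ∈ S, content m b = 0) → σ m * T = T * σ m) ∧
      ((∑ b ∈ S, content m b = 1) → σ m * T = -(T * σ m)) := by
  classical
  have z2 (x : ZMod 2) : x = 0 ∨ x = 1 := by revert x; decide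
  have z11 : (1 + 1 : ZMod 2) = 0 := by decide
  refine induction (P := fun m => ((∑ b ∈ S, content m b = 0) → σ m * T = T * σ m) ∧
      ((∑ b ∈ S, content m b = 1) → σ m * T = -(T * σ m))) (fun x => ?_) ?_ ?_ ?_ m
  · rw [content_of]
    cases x with
    | phase =>
      have e : ∑ b ∈ S, genContent (.phase : MGen G) b = (0 : ZMod 2) := by simp [genContent]
      exact ⟨fun _ => hI, fun h0 => absurd (e.symm.trans h0) zero_ne_one⟩
    | vert x =>
      by_cases h : .inl x ∈ S
      · have e : ∑ b ∈ S, genContent (.vert x) b = (1 : ZMod 2) := by simp [genContent, h]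
        exact ⟨fun h0 => absurd (h0.symm.trans e) zero_ne_one, fun _ => (hv x).2 h⟩
      · have e : ∑ b ∈ S, genContent (.vert x) b = (0 : ZMod 2) := by simp [genContent, h]
        exact ⟨fun _ => (hv x).1 h, fun h0 => absurd (e.symm.trans h0) zero_ne_one⟩
    | edge d =>
      by_cases h : .inr ⟨d.edge, d.edge_mem⟩ ∈ S
      · have e : ∑ b ∈ S, genContent (.edge d) b = (1 : ZMod 2) := by simp [genContent, h]
        exact ⟨fun h0 => absurd (h0.symm.trans e) zero_ne_one, fun _ => (he d).2 h⟩
      · have e : ∑ b ∈ S, genContent (.edge d) b = (0 : ZMod 2) := by simp [genContent, h]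
        exact ⟨fun _ => (he d).1 h, fun h0 => absurd (e.symm.trans h0) zero_ne_one⟩
  · simp [content_one]
  · intro a b ha hb
    simp only [content_mul, Pi.add_apply, Finset.sum_add_distrib, map_mul]
    rcases z2 (∑ b ∈ S, content a b) with h₁ | h₁ <;>
      rcases z2 (∑ c ∈ S, content b c) with h₂ | h₂ <;> rw [h₁, h₂] <;>
      simp only [h₁, h₂, true_implies, zero_ne_one, one_ne_zero, false_implies, and_true,
        true_and, add_zero, zero_add, z11] at ha hb ⊢
    all_goals rw [mul_assoc, hb]; simp only [mul_neg, ← mul_assoc, ha, neg_mul, neg_neg]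
  · intro a ha
    simp only [content_inv]
    have e₁ : σ a⁻¹ * σ a = 1 := by rw [← map_mul, inv_mul_cancel, map_one]
    have e₂ : σ a * σ a⁻¹ = 1 := by rw [← map_mul, mul_inv_cancel, map_one]
    -- Conjugation by `σ a⁻¹` carries the sign in the rule for `σ a` over to its inverse.
    have e₃ : σ a⁻¹ * T = σ a⁻¹ * (T * σ a) * σ a⁻¹ := by
      rw [mul_assoc, mul_assoc, e₂, mul_one]
    constructor
    · intro h
      rw [e₃, ← ha.1 h, ← mul_assoc, e₁, one_mul]
    · intro h
      rw [e₃, show T * σ a = -(σ a * T) by rw [ha.2 h, neg_neg], mul_neg, ← mul_assoc, e₁,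
        one_mul, neg_mul]

/-- An edge of an element of the kernel that anticommutes with `T` is not the only one. -/
theorem exists_edge_of_test [Finite V] {A : Type} [Ring A] (σ : MGroup G →* A) (T : A)
    (hT : T ≠ -T) (tv : V → Prop) (te : G.Dart → Prop)
    (hte : ∀ d d', d.edge = d'.edge → te d → te d') (hI : σ (I G) * T = T * σ (I G))
    (hv : ∀ x, (¬ tv x → σ (vert G x) * T = T * σ (vert G x)) ∧
      (tv x → σ (vert G x) * T = -(T * σ (vert G x))))
    (he : ∀ d, (¬ te d → σ (edge G d) * T = T * σ (edge G d)) ∧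
      (te d → σ (edge G d) * T = -(T * σ (edge G d))))
    {m : MGroup G} (hm : m ∈ cycleKernel G σ) {d : G.Dart} (hd : te d)
    (hmd : edgeContent m d = 1) :
    ∃ d', d'.edge ≠ d.edge ∧ te d' ∧ edgeContent m d' = 1 := by
  classical
  have : Fintype (V ⊕ G.edgeSet) := Fintype.ofFinite _
  have z2 (x : ZMod 2) : x ≠ 0 → x = 1 := by revert x; decide
  let S : Finset (V ⊕ G.edgeSet) := Finset.univ.filter
    (Sum.elim tv fun e => ∃ d : G.Dart, d.edge = e ∧ te d)
  have hSv (x : V) : .inl x ∈ S ↔ tv x := by simp [S]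
  have hSe (d : G.Dart) : .inr ⟨d.edge, d.edge_mem⟩ ∈ S ↔ te d := by
    simp only [S, Finset.mem_filter, Finset.mem_univ, true_and, Sum.elim_inr]
    exact ⟨fun ⟨d', h, h'⟩ => hte d' d h h', fun h => ⟨d, rfl, h⟩⟩
  by_contra hcon
  push Not at hcon
  -- If `d` were the only such edge, `σ m = 1` would anticommute with `T`, forcing `T = -T`.
  have hsum : ∑ b ∈ S, content m b = 1 := by
    rw [Finset.sum_eq_single_of_mem (.inr ⟨d.edge, d.edge_mem⟩) ((hSe d).2 hd)]
    · exact hmd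
    · rintro (x | ⟨e, he⟩) hb hne
      · exact content_inl_of_mem_cycles hm.1 x
      · induction e with
        | h x y =>
          let d' : G.Dart := ⟨(x, y), he⟩
          by_contra h0
          exact hcon d' (fun h => hne (congrArg Sum.inr (Subtype.ext h))) ((hSe d').1 hb) (z2 _ h0)
  have := (map_mul_test σ T S hI (fun x => by simpa only [hSv] using hv x)
    (fun d => by simpa only [hSe] using he d) m).2 hsum
  rw [show σ m = 1 from hm.2, one_mul, mul_one] at this
  exact hT this

end MGroup

/-! ### Generating sets detected by functionals modulo two -/

namespace Subgroup

variable {M ι : Type} [Group M]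

/-- The functional `Φ i` kills all other generators, hence their closure, but not `g i`. -/
theorem notMem_closure_image_compl_of_dual [DecidableEq ι] {g : ι → M}
    (Φ : ι → M →* Multiplicative (ZMod 2))
    (hΦ : ∀ i j, Φ i (g j) = .ofAdd (if i = j then 1 else 0)) (i : ι) :
    g i ∉ closure (g '' {i}ᶜ) := by
  intro h
  have hle : closure (g '' {i}ᶜ) ≤ (Φ i).ker := by
    rw [closure_le]
    rintro _ ⟨j, hj, rfl⟩
    have : i ≠ j := fun h => hj h.symm
    simp [MonoidHom.mem_ker, hΦ, this]
  have := (MonoidHom.mem_ker).1 (hle h)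
  rw [hΦ, if_pos rfl] at this
  exact absurd (Multiplicative.ofAdd.injective (this.trans ofAdd_zero.symm)) (by decide)

theorem injective_of_notMem_closure {g : ι → M} (h : ∀ i, g i ∉ closure (g '' {i}ᶜ)) :
    Function.Injective g := by
  intro i j hij
  by_contra hne
  exact h i (hij ▸ subset_closure ⟨j, fun h => hne h.symm, rfl⟩)

/-- The generators give the upper bound. For the lower one, the functionals together map `K` onto
the elementary abelian group of order 2 ^ |ι|, and the order of an abelian group divides its
exponent raised to its rank. -/
theorem rank_eq_card_of_dual [Fintype ι] [DecidableEq ι] {K : Subgroup M} {g : ι → M}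
    (hK : closure (Set.range g) = K) (Φ : ι → M →* Multiplicative (ZMod 2))
    (hΦ : ∀ i j, Φ i (g j) = .ofAdd (if i = j then 1 else 0)) :
    ∃ _ : Group.FG K, Group.rank K = Fintype.card ι := by
  classical
  subst hK
  have hfg : Group.FG (closure (Set.range g)) :=
    (Group.fg_iff_subgroup_fg _).2 ((fg_iff _).2 ⟨_, rfl, Set.finite_range g⟩)
  refine ⟨hfg, le_antisymm ?_ ?_⟩
  · refine (rank_closure_finite_le_nat_card (Set.range g)).trans ?_
    rw [← Nat.card_eq_fintype_card]
    exact Finite.card_range_le g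
  · let Ψ : closure (Set.range g) →* (ι → Multiplicative (ZMod 2)) :=
      (MonoidHom.pi Φ).comp (closure (Set.range g)).subtype
    have hΨ : Function.Surjective Ψ := by
      rw [← MonoidHom.range_eq_top, eq_top_iff]
      have gen (j : ι) (x : Multiplicative (ZMod 2)) : Pi.mulSingle j x ∈ Ψ.range := by
        have z2 (x : ZMod 2) : x = 0 ∨ x = 1 := by revert x; decide
        rcases z2 x.toAdd with h | h
        · rw [show x = 1 from h, Pi.mulSingle_one]; exact one_mem _
        · refine ⟨⟨g j, subset_closure ⟨j, rfl⟩⟩, ?_⟩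
          funext i
          change Φ i (g j) = _
          rw [hΦ, Pi.mulSingle_apply, show x = .ofAdd 1 from h]
          split_ifs <;> rfl
      intro y _
      rw [← Finset.univ_prod_mulSingle y]
      exact prod_mem fun j _ => gen j _
    refine le_trans ?_ (Group.rank_le_of_surjective Ψ hΨ)
    have h := card_dvd_exponent_pow_rank (ι → Multiplicative (ZMod 2))
    have hexp : Monoid.exponent (ι → Multiplicative (ZMod 2)) ∣ 2 :=
      Monoid.exponent_dvd_of_forall_pow_eq_one fun y => funext fun i => by
        rw [Pi.pow_apply, pow_two]
        exact CharTwo.add_self_eq_zero (y i).toAdd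
    have hcard : Nat.card (ι → Multiplicative (ZMod 2)) = 2 ^ Fintype.card ι := by
      rw [Nat.card_eq_fintype_card, Fintype.card_fun]
      rfl
    have := h.trans (pow_dvd_pow_of_dvd hexp _)
    rw [hcard] at this
    exact (Nat.pow_dvd_pow_iff_le_right (by norm_num)).1 this

end Subgroup

/-! ### Products of Pauli operators -/

namespace Pauli

theorem mat_mul_self (k : Fin 3) : mat k * mat k = 1 := by
  fin_cases k <;> ext i j <;> fin_cases i <;> fin_cases j <;> simp [mat, Matrix.mul_apply]

theorem mat_mul_mat {k l : Fin 3} (h : k ≠ l) : mat k * mat l = -(mat l * mat k) := by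
  fin_cases k <;> fin_cases l <;> first | exact absurd rfl h | skip
  all_goals ext i j; fin_cases i <;> fin_cases j <;> simp [mat, Matrix.mul_apply]

/-- The Pauli matrices, including the identity. -/
noncomputable def opt : Option (Fin 3) → Matrix (Fin 2) (Fin 2) ℂ
  | none => 1
  | some k => mat k

theorem opt_mul_self (a : Option (Fin 3)) : opt a * opt a = 1 := by
  cases a with
  | none => exact one_mul 1
  | some k => exact mat_mul_self k

/-- Two Pauli matrices that anticommute. -/
def Anti (a b : Option (Fin 3)) : Prop := a ≠ none ∧ b ≠ none ∧ a ≠ b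

theorem opt_mul_opt_of_not_anti {a b : Option (Fin 3)} (h : ¬ Anti a b) :
    opt a * opt b = opt b * opt a := by
  cases a with
  | none => exact (one_mul _).trans (mul_one _).symm
  | some k =>
    cases b with
    | none => exact (mul_one _).trans (one_mul _).symm
    | some l =>
      have : k = l := by
        by_contra hne
        exact h ⟨by simp, by simp, by simpa using hne⟩
      rw [this]

theorem opt_mul_opt_of_anti {a b : Option (Fin 3)} (h : Anti a b) :
    opt a * opt b = -(opt b * opt a) := by
  obtain ⟨ha, hb, hab⟩ := h
  obtain ⟨k, rfl⟩ := Option.ne_none_iff_exists'.1 ha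
  obtain ⟨l, rfl⟩ := Option.ne_none_iff_exists'.1 hb
  exact mat_mul_mat fun h => hab (congrArg some h)

variable {Q : Type} [Fintype Q]

theorem tensor_mul [DecidableEq Q] (P R : Q → Matrix (Fin 2) (Fin 2) ℂ) :
    tensor P * tensor R = tensor fun q => P q * R q := by
  ext a b
  simp only [tensor, Matrix.mul_apply, Matrix.of_apply]
  rw [Finset.prod_univ_sum, Fintype.piFinset_univ]
  exact Finset.sum_congr rfl fun x _ => Finset.prod_mul_distrib.symm

theorem tensor_one : tensor (fun _ : Q => (1 : Matrix (Fin 2) (Fin 2) ℂ)) = 1 := by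
  ext a b
  simp only [tensor, Matrix.of_apply, Matrix.one_apply]
  by_cases h : a = b
  · simp [h]
  · obtain ⟨q, hq⟩ := Function.ne_iff.1 h
    rw [if_neg h]
    exact Finset.prod_eq_zero (Finset.mem_univ q) (if_neg hq)

theorem tensor_eq_neg {P R : Q → Matrix (Fin 2) (Fin 2) ℂ} (q : Q) (hq : P q = -R q)
    (h : ∀ r, r ≠ q → P r = R r) : tensor P = -tensor R := by
  classical
  ext a b
  simp only [tensor, Matrix.of_apply, Matrix.neg_apply]
  rw [← Finset.mul_prod_erase _ _ (Finset.mem_univ q),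
    ← Finset.mul_prod_erase Finset.univ (fun q => R q (a q) (b q)) (Finset.mem_univ q), hq,
    Matrix.neg_apply, neg_mul]
  congr 2
  exact Finset.prod_congr rfl fun r hr => by rw [h r (Finset.ne_of_mem_erase hr)]

/-- A product of Pauli matrices on different qubits. -/
noncomputable def word (a : Q → Option (Fin 3)) : Matrix (Q → Fin 2) (Q → Fin 2) ℂ :=
  tensor fun q => opt (a q)

variable [DecidableEq Q]

theorem word_mul_self (a : Q → Option (Fin 3)) : word a * word a = 1 := by
  rw [word, tensor_mul, ← tensor_one]
  congr 1
  exact funext fun q => opt_mul_self _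

theorem word_mul_word_of_not_anti {a b : Q → Option (Fin 3)} (h : ∀ q, ¬ Anti (a q) (b q)) :
    word a * word b = word b * word a := by
  rw [word, word, tensor_mul, tensor_mul]
  congr 1
  exact funext fun q => opt_mul_opt_of_not_anti (h q)

theorem word_mul_word_of_anti {a b : Q → Option (Fin 3)} (q : Q) (hq : Anti (a q) (b q))
    (h : ∀ r, r ≠ q → ¬ Anti (a r) (b r)) : word a * word b = -(word b * word a) := by
  rw [word, word, tensor_mul, tensor_mul]
  exact tensor_eq_neg q (opt_mul_opt_of_anti hq) fun r hr => opt_mul_opt_of_not_anti (h r hr)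

/-- A Pauli word squares to 1, so it is nonzero. -/
theorem word_ne_neg_word (a : Q → Option (Fin 3)) : word a ≠ -word a := by
  intro h
  have h0 : word a = 0 := by
    have := add_eq_zero_iff_eq_neg.2 h
    rw [← two_smul ℂ] at this
    exact (smul_eq_zero.1 this).resolve_left two_ne_zero
  have := word_mul_self a
  rw [h0, zero_mul] at this
  exact zero_ne_one this

end Pauli

/-! ### Edges, faces and cells of the cubic lattice -/

namespace Cubic

variable {n : Fin 3 → ℕ}

theorem exists_third {k l : Fin 3} (h : k ≠ l) :
    ∃ m, m ≠ k ∧ m ≠ l ∧ ∀ j, j = k ∨ j = l ∨ j = m := by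
  revert k l; decide

theorem vertex_ext {v w : Vertex n} (h : ∀ k, (v k : ℕ) = w k) : v = w :=
  funext fun k => Fin.ext (h k)

/-- `v` and `w` are the two ends of an edge in direction `k`. -/
def Along (k : Fin 3) (v w : Vertex n) : Prop :=
  ((w k : ℕ) = v k + 1 ∨ (v k : ℕ) = w k + 1) ∧ ∀ l, l ≠ k → (v l : ℕ) = w l

theorem Along.symm {k : Fin 3} {v w : Vertex n} (h : Along k v w) : Along k w v :=
  ⟨h.1.symm, fun l hl => (h.2 l hl).symm⟩

theorem IsNext.along {k : Fin 3} {v w : Vertex n} (h : IsNext k v w) : Along k v w :=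
  ⟨.inl h.1, fun l hl => congrArg Fin.val (h.2 l hl).symm⟩

theorem Along.isNext {k : Fin 3} {v w : Vertex n} (h : Along k v w) (h' : (w k : ℕ) = v k + 1) :
    IsNext k v w :=
  ⟨h', fun l hl => Fin.ext (h.2 l hl).symm⟩

theorem Along.adj {k : Fin 3} {v w : Vertex n} (h : Along k v w) : (graph n).Adj v w :=
  ⟨k, h.1.imp h.isNext h.symm.isNext⟩

theorem exists_along {v w : Vertex n} (h : (graph n).Adj v w) : ∃ k, Along k v w := by
  obtain ⟨k, h | h⟩ := h
  · exact ⟨k, h.along⟩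
  · exact ⟨k, h.along.symm⟩

theorem Along.unique {k l : Fin 3} {v w : Vertex n} (h : Along k v w) (h' : Along l v w) :
    k = l := by
  by_contra hne
  have h₁ := h.1
  have h₂ := h'.2 k hne
  omega

theorem Along.dir_eq {k : Fin 3} {v w : Vertex n} (h : Along k v w) : dir v w = k := by
  have hk : v k ≠ w k := fun e => by
    have h₁ := h.1
    rw [e] at h₁
    omega
  have hl (l : Fin 3) (hl : l ≠ k) : v l = w l := Fin.ext (h.2 l hl)
  unfold dir
  fin_cases k
  · exact if_pos hk
  · rw [if_neg (not_not.2 (hl 0 (by decide)))]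
    exact if_pos hk
  · rw [if_neg (not_not.2 (hl 0 (by decide))), if_neg (not_not.2 (hl 1 (by decide)))]
    rfl

theorem dir_symm {v w : Vertex n} (h : (graph n).Adj v w) : dir w v = dir v w := by
  obtain ⟨k, hk⟩ := exists_along h
  rw [hk.dir_eq, hk.symm.dir_eq]

namespace Face

theorem HasVertex.axis_val {f : Face n} {w : Vertex n} (h : f.HasVertex w) :
    (w f.axis : ℕ) = f.corner f.axis :=
  congrArg Fin.val h.1

theorem exists_other {f : Face n} {k : Fin 3} (h : k ≠ f.axis) :
    ∃ l, l ≠ f.axis ∧ l ≠ k ∧ ∀ j, j = k ∨ j = l ∨ j = f.axis := by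
  obtain ⟨l, h₁, h₂, h₃⟩ := exists_third h
  exact ⟨l, h₂, h₁, fun j => by rcases h₃ j with h | h | h <;> simp [h]⟩

theorem ne_axis {f : Face n} {k : Fin 3} {v w : Vertex n} (hv : f.HasVertex v)
    (hw : f.HasVertex w) (h : Along k v w) : k ≠ f.axis := by
  rintro rfl
  have h₁ := hv.axis_val
  have h₂ := hw.axis_val
  have h₃ := h.1
  omega

theorem ext_val {f g : Face n} (h : f.axis = g.axis) (h' : ∀ k, (f.corner k : ℕ) = g.corner k) :
    f = g :=
  Face.ext h (vertex_ext h')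

theorem axis_eq {f : Face n} {k l m : Fin 3} (hk : k ≠ f.axis) (hl : l ≠ f.axis) (hkl : k ≠ l)
    (hm : m ≠ k) (hm' : m ≠ l) : f.axis = m := by
  generalize f.axis = a at *
  revert k l m a; decide

/-- Two perpendicular directions fix the normal, and an edge of unit length in each direction leaves
one possible corner coordinate there. -/
theorem eq_of_hasVertex {f g : Face n} {k l : Fin 3} {u v w : Vertex n} (huv : Along k u v)
    (hvw : Along l v w) (hkl : k ≠ l) (fu : f.HasVertex u) (fv : f.HasVertex v)
    (fw : f.HasVertex w) (gu : g.HasVertex u) (gv : g.HasVertex v) (gw : g.HasVertex w) :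
    f = g := by
  have hk := ne_axis fu fv huv
  have hl := ne_axis fv fw hvw
  have hk' := ne_axis gu gv huv
  have hl' := ne_axis gv gw hvw
  obtain ⟨m, h₁, h₂, h₃⟩ := exists_third hkl
  have hm : f.axis = m := axis_eq hk hl hkl h₁ h₂
  have hm' : g.axis = m := axis_eq hk' hl' hkl h₁ h₂
  refine ext_val (hm.trans hm'.symm) fun j => ?_
  rcases h₃ j with rfl | rfl | rfl
  · have a₁ := fu.2 _ hk
    have a₂ := fv.2 _ hk
    have a₃ := gu.2 _ hk'
    have a₄ := gv.2 _ hk'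
    have := huv.1
    omega
  · have a₁ := fv.2 _ hl
    have a₂ := fw.2 _ hl
    have a₃ := gv.2 _ hl'
    have a₄ := gw.2 _ hl'
    have := hvw.1
    omega
  · have a₁ := hm ▸ fv.axis_val
    have a₂ := hm' ▸ gv.axis_val
    omega

theorem exists_hasVertex {k l : Fin 3} {u v w : Vertex n} (huv : Along k u v)
    (hvw : Along l v w) (hkl : k ≠ l) :
    ∃ f : Face n, f.HasVertex u ∧ f.HasVertex v ∧ f.HasVertex w := by
  obtain ⟨m, h₁, h₂, h₃⟩ := exists_third hkl
  have hk := huv.1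
  have hl := hvw.1
  have hk' := hvw.2 k hkl
  have hl' := huv.2 l hkl.symm
  have hm := huv.2 m h₁
  have hm' := hvw.2 m h₂
  have bu := fun j => (u j).isLt
  have bv := fun j => (v j).isLt
  have bw := fun j => (w j).isLt
  have buk := bu k
  have bvk := bv k
  have bvl := bv l
  have bwl := bw l
  -- The points `u` and `w` are opposite vertices of the square, so their coordinatewise minimum is
  -- its smallest corner.
  let f : Face n :=
    { axis := m
      corner := fun j => ⟨min (u j) (w j), lt_of_le_of_lt (min_le_left _ _) (bu j)⟩
      lt := fun j hj => by
        rcases h₃ j with rfl | rfl | rfl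
        · simp only; omega
        · simp only; omega
        · exact absurd rfl hj }
  have coord (x : Vertex n) (xk : (x k : ℕ) = u k ∨ (x k : ℕ) = v k)
      (xl : (x l : ℕ) = v l ∨ (x l : ℕ) = w l) (xm : (x m : ℕ) = v m) : f.HasVertex x := by
    refine ⟨Fin.ext ?_, fun j hj => ?_⟩
    · simp only [f]; omega
    · simp only [f]
      rcases h₃ j with rfl | rfl | rfl
      · omega
      · omega
      · exact absurd rfl hj
  exact ⟨f, coord u (.inl rfl) (.inl hl') hm, coord v (.inr rfl) (.inl rfl) rfl,
    coord w (.inr hk'.symm) (.inr rfl) hm'.symm⟩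

/-- Perpendicular sides of a square always meet. This is why disjoint edges never anticommute on a
face qubit. -/
theorem common_vertex {f : Face n} {k l : Fin 3} {v w v' w' : Vertex n} (h : Along k v w)
    (h' : Along l v' w') (hkl : k ≠ l) (fv : f.HasVertex v) (fw : f.HasVertex w)
    (fv' : f.HasVertex v') (fw' : f.HasVertex w') : v = v' ∨ v = w' ∨ w = v' ∨ w = w' := by
  have hk := ne_axis fv fw h
  have hl := ne_axis fv' fw' h'
  obtain ⟨m, h₁, h₂, h₃⟩ := exists_third hkl
  have hm : f.axis = m := axis_eq hk hl hkl h₁ h₂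
  subst hm
  have key (x y : Vertex n) (fx : f.HasVertex x) (fy : f.HasVertex y) (hxk : (x k : ℕ) = y k)
      (hxl : (x l : ℕ) = y l) : x = y := by
    refine vertex_ext fun j => ?_
    rcases h₃ j with rfl | rfl | rfl
    · exact hxk
    · exact hxl
    · rw [fx.axis_val, fy.axis_val]
  have a₁ := fv.2 k hk
  have a₂ := fw.2 k hk
  have a₃ := fv'.2 k hk
  have b₁ := fv'.2 l hl
  have b₂ := fw'.2 l hl
  have b₃ := fv.2 l hl
  have c₁ := h.1
  have c₂ := h'.1
  have d₁ := h.2 l hkl.symm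
  have d₂ := h'.2 k hkl
  by_cases e₁ : (v k : ℕ) = v' k <;> by_cases e₂ : (v l : ℕ) = v' l
  · exact .inl (key _ _ fv fv' e₁ e₂)
  · exact .inr (.inl (key _ _ fv fw' (by omega) (by omega)))
  · exact .inr (.inr (.inl (key _ _ fw fv' (by omega) (by omega))))
  · exact .inr (.inr (.inr (key _ _ fw fw' (by omega) (by omega))))

end Face

/-! ### Orientations -/

namespace Orientation

variable (o : Orientation n)

theorem not_even_of_odd {f : Face n} {u v w : Vertex n} (huv : (graph n).Adj u v)
    (hvw : (graph n).Adj v w) (huw : u ≠ w) (fu : f.HasVertex u) (fv : f.HasVertex v)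
    (fw : f.HasVertex w) (h : IsOddFace o.pointsTo f) : ¬ IsEvenFace o.pointsTo f := by
  intro h'
  have h₁ := h u v w fu fv fw huv hvw huw
  have h₂ := h' u v w fu fv fw huv hvw huw
  rw [h₁, o.pointsTo_symm v w hvw] at h₂
  cases h : o.pointsTo v w <;> simp [h] at h₂

/-- A face is odd if two of its edges touch head to head or tail to tail. -/
theorem odd_iff {f : Face n} {u v w : Vertex n} (huv : (graph n).Adj u v)
    (hvw : (graph n).Adj v w) (huw : u ≠ w) (fu : f.HasVertex u) (fv : f.HasVertex v)
    (fw : f.HasVertex w) :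
    IsOddFace o.pointsTo f ↔ o.pointsTo v u = o.pointsTo v w := by
  rw [o.pointsTo_symm u v huv]
  constructor
  · intro h
    rw [h u v w fu fv fw huv hvw huw, o.pointsTo_symm v w hvw, Bool.not_not]
  · intro h
    refine (o.even_or_odd f).resolve_left fun h' => ?_
    rw [h' u v w fu fv fw huv hvw huw] at h
    cases h₁ : o.pointsTo v w <;> simp [h₁] at h

/-- Opposite sides are antiparallel in both cases: around an even face they circulate, and around an
odd face sources and sinks alternate. -/
theorem pointsTo_parallel {f : Face n} {k l : Fin 3} {u v u' v' : Vertex n} (huv : Along k u v)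
    (huv' : Along k u' v') (huu : Along l u u') (hvv : Along l v v') (hkl : k ≠ l)
    (fu : f.HasVertex u) (fv : f.HasVertex v) (fu' : f.HasVertex u') (fv' : f.HasVertex v') :
    o.pointsTo u' v' = !o.pointsTo u v := by
  have ne₁ : v ≠ u' := fun h => hkl (huv.unique (h ▸ huu))
  have ne₂ : u ≠ v' := fun h => hkl (huv.symm.unique (h ▸ hvv))
  have s₁ := o.pointsTo_symm u v huv.adj
  have s₂ := o.pointsTo_symm u' v' huv'.adj
  have s₃ := o.pointsTo_symm u u' huu.adj
  rcases o.even_or_odd f with h | h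
  · rw [← h u u' v' fu fu' fv' huu.adj huv'.adj ne₂,
      ← h v u u' fv fu fu' huv.symm.adj huu.adj ne₁, s₁]
  · have h₁ := h v u u' fv fu fu' huv.symm.adj huu.adj ne₁
    have h₂ := h u u' v' fu fu' fv' huu.adj huv'.adj ne₂
    rw [s₁, s₃] at h₁
    rw [s₂] at h₂
    rw [← Bool.not_not (o.pointsTo u' v'), ← h₂, Bool.not_inj h₁]

theorem exists_along_of_pos (hn : ∀ k, 0 < n k) (l : Fin 3) (v : Vertex n) :
    ∃ v', Along l v v' := by
  have hl := (v l).isLt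
  have hpos := hn l
  by_cases h : (v l : ℕ) < n l
  · exact ⟨Function.update v l ⟨v l + 1, by omega⟩, .inl (by simp),
      fun j hj => by rw [Function.update_of_ne hj]⟩
  · exact ⟨Function.update v l ⟨v l - 1, by omega⟩, .inr (by simp; omega),
      fun j hj => by rw [Function.update_of_ne hj]⟩

/-- Consecutive edges on a straight line point in the same direction. -/
theorem pointsTo_collinear (hn : ∀ k, 0 < n k) {k : Fin 3} {u v w : Vertex n}
    (huv : Along k u v) (hvw : Along k v w) (huw : u ≠ w) :
    o.pointsTo u v = o.pointsTo v w := by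
  obtain ⟨l, hlk⟩ : ∃ l, l ≠ k := exists_ne k
  -- The edge from `v` to a neighbour `v'` off the line separates two faces `f` and `g` of one
  -- slice. Exactly one of them is odd, so comparing both edges of the line with `v v'` shows that
  -- one enters `v` and the other leaves it.
  obtain ⟨v', hv'⟩ := exists_along_of_pos hn l v
  obtain ⟨f, fu, fv, fv'⟩ := Face.exists_hasVertex huv hv' hlk.symm
  obtain ⟨g, gw, gv, gv'⟩ := Face.exists_hasVertex hvw.symm hv' hlk.symm
  obtain ⟨m, h₁, h₂, h₃⟩ := exists_third hlk
  have fk := Face.ne_axis fu fv huv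
  have fl := Face.ne_axis fv fv' hv'
  have gk := Face.ne_axis gw gv hvw.symm
  have gl := Face.ne_axis gv gv' hv'
  have hm : f.axis = m := Face.axis_eq fk fl hlk.symm h₂ h₁
  have hm' : g.axis = m := Face.axis_eq gk gl hlk.symm h₂ h₁
  have fuk := fu.2 k fk
  have fvk := fv.2 k fk
  have gwk := gw.2 k gk
  have gvk := gv.2 k gk
  have fvl := fv.2 l fl
  have fvl' := fv'.2 l fl
  have gvl := gv.2 l gl
  have gvl' := gv'.2 l gl
  have e₁ := huv.1
  have e₂ := hvw.1
  have e₃ := hv'.1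
  have fm := hm ▸ fv.axis_val
  have gm := hm' ▸ gv.axis_val
  have hne : (u k : ℕ) ≠ w k := fun h => huw (vertex_ext fun j => by
    by_cases hj : j = k
    · rw [hj, h]
    · rw [huv.2 j hj, hvw.2 j hj])
  have along : Along k f.corner g.corner := by
    refine ⟨by omega, fun j hj => ?_⟩
    rcases h₃ j with rfl | rfl | rfl
    · omega
    · exact absurd rfl hj
    · omega
  have slice : f.AdjInSlice g := ⟨hm.trans hm'.symm, k, fk,
    along.1.imp along.isNext along.symm.isNext⟩
  have nuv : u ≠ v' := fun h => hlk.symm (huv.symm.unique (h ▸ hv'))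
  have nwv : w ≠ v' := fun h => hlk.symm (hvw.unique (h ▸ hv'))
  have of := o.odd_iff huv.adj hv'.adj nuv fu fv fv'
  have og := o.odd_iff hvw.symm.adj hv'.adj nwv gw gv gv'
  have key : IsOddFace o.pointsTo f ↔ ¬ IsOddFace o.pointsTo g := by
    rw [o.checkerboard f g slice]
    constructor
    · exact fun h h' => o.not_even_of_odd hvw.symm.adj hv'.adj nwv gw gv gv' h' h
    · exact fun h => (o.even_or_odd g).resolve_right h
  rw [of, og, o.pointsTo_symm u v huv.adj] at key
  cases h₁ : o.pointsTo u v <;> cases h₂ : o.pointsTo v w <;> cases h₃ : o.pointsTo v v' <;>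
    simp [h₁, h₂, h₃] at key ⊢

end Orientation

end Cubic

namespace Cubic

variable {n : Fin 3 → ℕ}

/-! ### Parity of faces and cells -/

/-- The orientation of an edge is determined by the parity of its coordinates. -/
theorem Orientation.exists_parity_edge (hn : ∀ k, 0 < n k) (o : Orientation n) :
    ∃ a : Fin 3 → ℕ, ∀ k (v w : Vertex n), IsNext k v w →
      (o.pointsTo v w = true ↔ (a k + v k + v 0 + v 1 + v 2) % 2 = 1) := by
  have exist (k : Fin 3) : ∃ w : Vertex n, IsNext k (fun _ => 0) w :=
    ⟨Function.update (fun _ => 0) k ⟨1, by have := hn k; omega⟩, by simp,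
      fun l hl => Function.update_of_ne hl _ _⟩
  choose e he using exist
  -- The shift `a k` records the direction of the edge at the origin along axis `k`.
  refine ⟨fun k => if o.pointsTo (fun _ => 0) (e k) then 1 else 0, fun k v => ?_⟩
  have sum_eq (l : Fin 3) (x y : Vertex n) (h : (x l : ℕ) = y l + 1)
      (h' : ∀ j, j ≠ l → (y j : ℕ) = x j) :
      (x 0 + x 1 + x 2 : ℕ) = y 0 + y 1 + y 2 + 1 := by
    fin_cases l
    · change (x 0 : ℕ) = y 0 + 1 at h
      have h₁ := h' 1 (by decide)
      have h₂ := h' 2 (by decide)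
      omega
    · change (x 1 : ℕ) = y 1 + 1 at h
      have h₁ := h' 0 (by decide)
      have h₂ := h' 2 (by decide)
      omega
    · change (x 2 : ℕ) = y 2 + 1 at h
      have h₁ := h' 0 (by decide)
      have h₂ := h' 1 (by decide)
      omega
  -- Move one step towards the origin in some direction `l`. For `l = k` the orientation persists
  -- along the line and the expression drops by 2; for `l ≠ k` the parallel edge is reversed and the
  -- expression drops by 1.
  induction hs : (v 0 + v 1 + v 2 : ℕ) using Nat.strong_induction_on generalizing v with
  | _ s ih =>
  intro w hvw
  by_cases hv : ∃ l, (v l : ℕ) ≠ 0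
  · obtain ⟨l, hl⟩ := hv
    let v' : Vertex n := Function.update v l ⟨v l - 1, by have := (v l).isLt; omega⟩
    have hv'l : (v' l : ℕ) = v l - 1 := by simp [v']
    have hv'j (j : Fin 3) (hj : j ≠ l) : (v' j : ℕ) = v j := by simp [v', hj]
    have al : Along l v' v := ⟨.inl (by omega), hv'j⟩
    have hsum := sum_eq l v v' (by omega) hv'j
    by_cases hlk : l = k
    · subst hlk
      have := ih _ (by omega) v' rfl v (al.isNext (by omega))
      have hne : v' ≠ w := fun h => by
        have h₁ := hvw.1
        rw [← h] at h₁
        omega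
      rw [← o.pointsTo_collinear hn al hvw.along hne, this]
      omega
    · let w' : Vertex n := Function.update w l ⟨w l - 1, by have := (w l).isLt; omega⟩
      have hw'l : (w' l : ℕ) = w l - 1 := by simp [w']
      have hw'j (j : Fin 3) (hj : j ≠ l) : (w' j : ℕ) = w j := by simp [w', hj]
      have hwl := hvw.along.2 l hlk
      have al' : Along l w' w := ⟨.inl (by omega), hw'j⟩
      have kk : Along k v' w' := by
        refine ⟨.inl ?_, fun j hj => ?_⟩
        · rw [hv'j k (Ne.symm hlk), hw'j k (Ne.symm hlk), hvw.1]
        · by_cases h : j = l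
          · subst h; omega
          · rw [hv'j j h, hw'j j h, hvw.along.2 j hj]
      have next : IsNext k v' w' :=
        kk.isNext (by rw [hv'j k (Ne.symm hlk), hw'j k (Ne.symm hlk), hvw.1])
      have := ih _ (by omega) v' rfl w' next
      obtain ⟨f, f₁, f₂, f₃⟩ := Face.exists_hasVertex kk.symm al (Ne.symm hlk)
      have f₄ : f.HasVertex w := by
        have hk := Face.ne_axis f₂ f₁ kk
        have hl := Face.ne_axis f₂ f₃ al
        obtain ⟨m, h₁, h₂, h₃⟩ := exists_third hlk
        have hm : f.axis = m := Face.axis_eq hl hk hlk h₁ h₂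
        subst hm
        refine ⟨Fin.ext ?_, fun j hj => ?_⟩
        · rw [← hw'j _ h₁]; exact f₁.axis_val
        · rcases h₃ j with rfl | rfl | rfl
          · rw [← hwl]; exact f₃.2 _ hj
          · rw [← hw'j j (Ne.symm hlk)]; exact f₁.2 _ hj
          · exact absurd rfl hj
      rw [o.pointsTo_parallel kk hvw.along al al' (Ne.symm hlk) f₂ f₁ f₃ f₄, Bool.not_eq_true',
        ← Bool.not_eq_true, this, hv'j k (Ne.symm hlk)]
      omega
  · push Not at hv
    have hv0 : v = fun _ => 0 := vertex_ext hv
    have hw : w = e k := vertex_ext fun j => by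
      subst hv0
      by_cases hj : j = k
      · subst hj; rw [hvw.1, (he j).1]
      · rw [hvw.2 j hj, (he k).2 j hj]
    subst hv0 hw
    cases h : o.pointsTo (fun _ => 0) (e k) <;> simp [h]

/-- Whether a face is odd is determined by the parity of its coordinates, shifted by `a`. -/
def IsParity (o : Orientation n) (a : Fin 3 → ℕ) : Prop :=
  ∀ (f : Face n) (k l : Fin 3), k ≠ f.axis → l ≠ f.axis → k ≠ l →
    (IsOddFace o.pointsTo f ↔ (f.corner k + a k) % 2 = (f.corner l + a l) % 2)

/-- A face is odd iff its two edges at the corner both leave or both enter. In the parity formula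
for these edges the coordinate sum is common and cancels. -/
theorem exists_isParity (hn : ∀ k, 0 < n k) (o : Orientation n) : ∃ a, IsParity o a := by
  obtain ⟨a, ha⟩ := o.exists_parity_edge hn
  refine ⟨a, fun f k l hk hl hkl => ?_⟩
  have bk := f.lt k hk
  have bl := f.lt l hl
  have next (j : Fin 3) (h : (f.corner j : ℕ) < n j) : IsNext j f.corner (up f.corner j h) :=
    ⟨by simp [up], fun i hi => by simp [up, Function.update_of_ne hi]⟩
  have mem (j : Fin 3) (hj : j ≠ f.axis) (h : (f.corner j : ℕ) < n j) :
      f.HasVertex (up f.corner j h) := by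
    refine ⟨by simp [up, Function.update_of_ne hj.symm], fun i hi => ?_⟩
    by_cases h : i = j
    · subst h; simp [up]
    · simp [up, Function.update_of_ne h]
  have hc : f.HasVertex f.corner := ⟨rfl, fun _ _ => .inl rfl⟩
  have nk := next k bk
  have nl := next l bl
  have hne : up f.corner k bk ≠ up f.corner l bl := fun h => by
    rw [← h] at nl
    exact hkl (nk.along.unique nl.along)
  rw [o.odd_iff nk.along.symm.adj nl.along.adj hne (mem k hk bk) hc (mem l hl bl),
    Bool.eq_iff_iff, ha _ _ _ nk, ha _ _ _ nl]
  omega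

theorem Face.isFaceOf_iff {f : Face n} {c : Cell n} :
    f.IsFaceOf c ↔ (∀ j, j ≠ f.axis → (f.corner j : ℕ) = c j) ∧
      ((f.corner f.axis : ℕ) = c f.axis ∨ (f.corner f.axis : ℕ) = c f.axis + 1) := by
  constructor
  · rintro ⟨k, rfl | rfl⟩
    · exact ⟨fun j _ => rfl, .inl rfl⟩
    · refine ⟨fun j hj => ?_, .inr ?_⟩
      · change ((Function.update (fun l => (c l).castSucc) k (c k).succ j : Fin _) : ℕ) = _
        rw [Function.update_of_ne (show j ≠ k from hj)]
        rfl
      · change ((Function.update (fun l => (c l).castSucc) k (c k).succ k : Fin _) : ℕ) = _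
        rw [Function.update_self]
        rfl
  · rintro ⟨h, h' | h'⟩
    · refine ⟨f.axis, .inl (Face.ext_val rfl fun j => ?_)⟩
      by_cases hj : j = f.axis
      · subst hj; exact h'
      · exact h j hj
    · refine ⟨f.axis, .inr (Face.ext_val rfl fun j => ?_)⟩
      change _ = ((Function.update (fun l => (c l).castSucc) f.axis (c f.axis).succ j : Fin _) : ℕ)
      by_cases hj : j = f.axis
      · subst hj; rw [Function.update_self]; exact h'
      · rw [Function.update_of_ne hj]; exact h j hj

/-- The face with the third direction as normal compares any two given coordinates. -/
theorem IsParity.isOddCell_iff {o : Orientation n} {a : Fin 3 → ℕ} (ha : IsParity o a)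
    {c : Cell n} : IsOddCell o c ↔ ∀ k l, (c k + a k) % 2 = (c l + a l) % 2 := by
  constructor
  · intro h k l
    by_cases hkl : k = l
    · rw [hkl]
    · obtain ⟨m, h₁, h₂, -⟩ := exists_third hkl
      exact (ha (c.lower m) k l h₁.symm h₂.symm hkl).1 (h _ ⟨m, .inl rfl⟩)
  · intro h f hf
    obtain ⟨k, hk⟩ := exists_ne f.axis
    obtain ⟨l, hl, hlk, -⟩ := Face.exists_other hk
    have := (Face.isFaceOf_iff.1 hf).1
    rw [ha f k l hk hl hlk.symm, this k hk, this l hl]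
    exact h k l

/-- `w` is one of the eight vertices of the cell `c`. -/
def Cell.HasVertex (c : Cell n) (w : Vertex n) : Prop :=
  ∀ j, (w j : ℕ) = c j ∨ (w j : ℕ) = c j + 1

theorem Face.hasVertex_iff_of_isFaceOf {f : Face n} {c : Cell n} (h : f.IsFaceOf c)
    {w : Vertex n} :
    f.HasVertex w ↔ Cell.HasVertex c w ∧ (w f.axis : ℕ) = f.corner f.axis := by
  obtain ⟨h₁, h₂⟩ := Face.isFaceOf_iff.1 h
  constructor
  · intro hw
    refine ⟨fun j => ?_, hw.axis_val⟩
    by_cases hj : j = f.axis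
    · subst hj; rw [hw.axis_val]; exact h₂
    · rw [← h₁ j hj]; exact hw.2 j hj
  · rintro ⟨hw, hw'⟩
    refine ⟨Fin.ext hw', fun j hj => ?_⟩
    rw [h₁ j hj]; exact hw j

/-- An odd face that contains an edge of an odd cell is a face of it. -/
theorem isFaceOf_of_isOddCell {o : Orientation n} {a : Fin 3 → ℕ} (ha : IsParity o a)
    {c : Cell n} (hc : IsOddCell o c) {g : Face n} (hg : IsOddFace o.pointsTo g) {k : Fin 3}
    {v w : Vertex n} (hvw : Along k v w) (cv : Cell.HasVertex c v) (cw : Cell.HasVertex c w)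
    (gv : g.HasVertex v) (gw : g.HasVertex w) : g.IsFaceOf c := by
  have hk := Face.ne_axis gv gw hvw
  obtain ⟨l, hl, hlk, h⟩ := Face.exists_other hk
  have p₁ := (ha g k l hk hl hlk.symm).1 hg
  have p₂ := ha.isOddCell_iff.1 hc k l
  have a₁ := cv k
  have a₂ := cw k
  have a₃ := gv.2 k hk
  have a₄ := gw.2 k hk
  have a₅ := hvw.1
  have b₁ := cv l
  have b₂ := gv.2 l hl
  rw [Face.isFaceOf_iff, ← gv.axis_val]
  refine ⟨fun j hj => ?_, cv _⟩
  -- Along `k` the edge itself fixes the coordinate. Along `l` two candidates remain, differing by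
  -- 1, and parity selects one.
  rcases h j with rfl | rfl | rfl
  · omega
  · omega
  · exact absurd rfl hj

/-- An isolated odd face shares no edge with another odd face. -/
theorem eq_of_isIsolatedOddFace {o : Orientation n} {a : Fin 3 → ℕ} (ha : IsParity o a)
    {f g : Face n} (hf : IsIsolatedOddFace o f) (hg : IsOddFace o.pointsTo g) {k : Fin 3}
    {v w : Vertex n} (hvw : Along k v w) (fv : f.HasVertex v) (fw : f.HasVertex w)
    (gv : g.HasVertex v) (gw : g.HasVertex w) : g = f := by
  have hk := Face.ne_axis fv fw hvw
  have hk' := Face.ne_axis gv gw hvw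
  obtain ⟨l, hl, hlk, h⟩ := Face.exists_other hk
  have p := (ha f k l hk hl hlk.symm).1 hf.1
  have a₁ := fv.2 k hk
  have a₂ := fw.2 k hk
  have a₃ := gv.2 k hk'
  have a₄ := gw.2 k hk'
  have a₅ := hvw.1
  have b₁ := fv.2 l hl
  rcases h g.axis with hax | hax | hax
  · exact absurd hax.symm hk'
  · exfalso
    have hm' : f.axis ≠ g.axis := fun e => hl (hax.symm.trans e.symm)
    have p' := (ha g k f.axis hk' hm' hk).1 hg
    have c₁ := gv.2 f.axis hm'
    have c₂ := fv.axis_val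
    have b₂ := hax ▸ gv.axis_val
    have lt₁ := f.lt k hk
    have lt₂ := f.lt l hl
    have lt₃ := g.lt f.axis hm'
    -- Perpendicular odd faces with a common edge span a cell whose shifted coordinates all have
    -- equal parity. It is odd and has `f` as a face, against isolation.
    let c : Cell n := fun j =>
      ⟨if j = f.axis then g.corner j else f.corner j, by
        split_ifs with hj
        · subst hj; exact lt₃
        · exact f.lt j hj⟩
    have ck : (c k : ℕ) = f.corner k := if_neg hk
    have cl : (c l : ℕ) = f.corner l := if_neg hl
    have cm : (c f.axis : ℕ) = g.corner f.axis := if_pos rfl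
    have hodd : IsOddCell o c := by
      rw [ha.isOddCell_iff]
      have key (j : Fin 3) : (c j + a j) % 2 = (f.corner k + a k) % 2 := by
        rcases h j with rfl | rfl | rfl <;> omega
      intro i j
      rw [key i, key j]
    refine hf.2.2 c hodd (Face.isFaceOf_iff.2 ⟨fun j hj => (if_neg hj).symm, ?_⟩)
    omega
  -- Within one slice, neighbouring faces have opposite parity, so only `g = f` remains.
  · have hl' : l ≠ g.axis := hax ▸ hl
    have p' := (ha g k l hk' hl' hlk.symm).1 hg
    have b₂ := gv.2 l hl'
    refine Face.ext_val hax fun j => ?_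
    rcases h j with rfl | rfl | rfl
    · omega
    · omega
    · rw [← fv.axis_val, ← hax, ← gv.axis_val]

/-- An odd face belongs to at most one odd cell. -/
theorem oddCell_eq_of_isFaceOf {o : Orientation n} {a : Fin 3 → ℕ} (ha : IsParity o a)
    {f : Face n} {c c' : Cell n} (hc : IsOddCell o c) (hc' : IsOddCell o c')
    (h : f.IsFaceOf c) (h' : f.IsFaceOf c') : c = c' := by
  obtain ⟨h₁, h₂⟩ := Face.isFaceOf_iff.1 h
  obtain ⟨h₁', h₂'⟩ := Face.isFaceOf_iff.1 h'
  obtain ⟨k, hk⟩ := exists_ne f.axis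
  have p := ha.isOddCell_iff.1 hc k f.axis
  have p' := ha.isOddCell_iff.1 hc' k f.axis
  have e := h₁ k hk
  have e' := h₁' k hk
  refine funext fun j => Fin.ext ?_
  by_cases hj : j = f.axis
  · subst hj; omega
  · rw [← h₁ j hj, ← h₁' j hj]

/-- An odd face is isolated or belongs to an odd cell. -/
theorem exists_oddCell_or_isolated {o : Orientation n} {a : Fin 3 → ℕ} (ha : IsParity o a)
    {f : Face n} (hf : IsOddFace o.pointsTo f) :
    IsIsolatedOddFace o f ∨ ∃ c, IsOddCell o c ∧ f.IsFaceOf c := by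
  by_cases hb : f.IsBoundary
  · by_cases h : ∃ c, IsOddCell o c ∧ f.IsFaceOf c
    · exact .inr h
    · exact .inl ⟨hf, hb, fun c hc hfc => h ⟨c, hc, hfc⟩⟩
  · right
    obtain ⟨k, hk⟩ := exists_ne f.axis
    obtain ⟨l, hl, hlk, h⟩ := Face.exists_other hk
    have p := (ha f k l hk hl hlk.symm).1 hf
    unfold Face.IsBoundary at hb
    have hlt := (f.corner f.axis).isLt
    -- An interior face has cells on both sides. Their normal coordinates are consecutive, and `t`
    -- is the one of the required parity.
    obtain ⟨t, ht, htp, htf⟩ : ∃ t, t < n f.axis ∧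
        (t + a f.axis) % 2 = (f.corner k + a k) % 2 ∧
        ((f.corner f.axis : ℕ) = t ∨ (f.corner f.axis : ℕ) = t + 1) := by
      by_cases he : (f.corner f.axis + a f.axis) % 2 = (f.corner k + a k) % 2
      · exact ⟨f.corner f.axis, by omega, he, .inl rfl⟩
      · exact ⟨f.corner f.axis - 1, by omega, by omega, by omega⟩
    let c : Cell n := fun j => ⟨if j = f.axis then t else f.corner j, by
      split_ifs with hj
      · subst hj; exact ht
      · exact f.lt j hj⟩
    have ck : (c k : ℕ) = f.corner k := if_neg hk
    have cl : (c l : ℕ) = f.corner l := if_neg hl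
    have cm : (c f.axis : ℕ) = t := if_pos rfl
    refine ⟨c, ?_, Face.isFaceOf_iff.2 ⟨fun j hj => (if_neg hj).symm, by rw [cm]; exact htf⟩⟩
    rw [ha.isOddCell_iff]
    have key (j : Fin 3) : (c j + a j) % 2 = (f.corner k + a k) % 2 := by
      rcases h j with rfl | rfl | rfl <;> omega
    intro i j
    rw [key i, key j]

end Cubic

/-! ### The cubic encoding -/

namespace Cubic

open Pauli

variable {n : Fin 3 → ℕ}

/-! ### Pauli labels of the generators and their commutation rules -/

section Labels

variable (o : Orientation n)

/-- The Pauli matrix of `Z_v` on each qubit. -/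
def vertexLabel (v : Vertex n) : Qubit o → Option (Fin 3) :=
  fun q => if q = .inl v then some 2 else none

/-- The Pauli matrix of `X_v Y_w P(v, w)` on each qubit. -/
def rawLabel (v w : Vertex n) : Qubit o → Option (Fin 3)
  | .inl u => if u = v then some 0 else if u = w then some 1 else none
  | .inr f => if f.1.HasVertex v ∧ f.1.HasVertex w then some (dir v w) else none

theorem vertexOp_eq (v : Vertex n) : vertexOp o v = word (vertexLabel o v) := by
  unfold vertexOp word vertexLabel
  congr 1
  funext q
  split_ifs <;> rfl

theorem rawEdgeOp_eq (v w : Vertex n) : rawEdgeOp o v w = word (rawLabel o v w) := by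
  unfold rawEdgeOp word
  congr 1
  funext q
  cases q <;> simp only [rawLabel] <;> split_ifs <;> rfl

/-- The Pauli matrix of the operator of a directed edge on each qubit. -/
def edgeLabel (d : (graph n).Dart) : Qubit o → Option (Fin 3) :=
  if o.pointsTo d.fst d.snd then rawLabel o d.fst d.snd else rawLabel o d.snd d.fst

theorem edgeLabel_symm (d : (graph n).Dart) : edgeLabel o d.symm = edgeLabel o d := by
  have h := o.pointsTo_symm d.fst d.snd d.adj
  unfold edgeLabel
  change (if o.pointsTo d.snd d.fst then rawLabel o d.snd d.fst else rawLabel o d.fst d.snd) = _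
  cases h' : o.pointsTo d.fst d.snd <;> simp [h, h']

theorem edgeLabel_congr {d d' : (graph n).Dart} (h : d.edge = d'.edge) :
    edgeLabel o d = edgeLabel o d' := by
  rcases (SimpleGraph.dart_edge_eq_iff _ _).1 h with rfl | rfl
  · rfl
  · exact edgeLabel_symm o d'

theorem edgeLabel_fst (d : (graph n).Dart) :
    edgeLabel o d (.inl d.fst) = some (if o.pointsTo d.fst d.snd then 0 else 1) := by
  unfold edgeLabel
  split_ifs
  · simp [rawLabel]
  · simp [rawLabel, d.adj.ne]

theorem edgeLabel_snd (d : (graph n).Dart) :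
    edgeLabel o d (.inl d.snd) = some (if o.pointsTo d.fst d.snd then 1 else 0) := by
  unfold edgeLabel
  split_ifs
  · simp [rawLabel, d.adj.ne']
  · simp [rawLabel]

theorem edgeLabel_inl_of_ne {d : (graph n).Dart} {u : Vertex n} (h₁ : u ≠ d.fst)
    (h₂ : u ≠ d.snd) : edgeLabel o d (.inl u) = none := by
  unfold edgeLabel
  split_ifs <;> simp [rawLabel, h₁, h₂]

theorem edgeLabel_inr (d : (graph n).Dart) (f : OddFace o) :
    edgeLabel o d (.inr f) =
      if f.1.HasVertex d.fst ∧ f.1.HasVertex d.snd then some (dir d.fst d.snd) else none := by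
  unfold edgeLabel
  split_ifs with h₁ h₂ h₂ <;> simp [rawLabel, h₂, and_comm, dir_symm d.adj]

variable {o}

theorem mem_of_anti_inl {d d' : (graph n).Dart} {u : Vertex n}
    (h : Anti (edgeLabel o d (.inl u)) (edgeLabel o d' (.inl u))) :
    (u = d.fst ∨ u = d.snd) ∧ (u = d'.fst ∨ u = d'.snd) := by
  constructor <;> by_contra hne <;> push Not at hne
  · exact h.1 (edgeLabel_inl_of_ne o hne.1 hne.2)
  · exact h.2.1 (edgeLabel_inl_of_ne o hne.1 hne.2)

theorem hasVertex_of_anti_inr {d d' : (graph n).Dart} {f : OddFace o}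
    (h : Anti (edgeLabel o d (.inr f)) (edgeLabel o d' (.inr f))) :
    (f.1.HasVertex d.fst ∧ f.1.HasVertex d.snd) ∧
      (f.1.HasVertex d'.fst ∧ f.1.HasVertex d'.snd) ∧ dir d.fst d.snd ≠ dir d'.fst d'.snd := by
  obtain ⟨h₁, h₂, h₃⟩ := h
  rw [edgeLabel_inr] at h₁ h₂ h₃
  rw [edgeLabel_inr] at h₃
  have e₁ := of_not_not fun h => h₁ (if_neg h)
  have e₂ := of_not_not fun h => h₂ (if_neg h)
  rw [if_pos e₁, if_pos e₂] at h₃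
  exact ⟨e₁, e₂, fun h => h₃ (congrArg some h)⟩

/-- Disjoint edges share no vertex qubit. On a shared face qubit their Pauli matrices could differ
only for perpendicular sides, which would meet. -/
theorem word_edge_mul_word_edge {d d' : (graph n).Dart} (h₁ : d.fst ≠ d'.fst)
    (h₂ : d.fst ≠ d'.snd) (h₃ : d.snd ≠ d'.fst) (h₄ : d.snd ≠ d'.snd) :
    word (edgeLabel o d) * word (edgeLabel o d') =
      word (edgeLabel o d') * word (edgeLabel o d) := by
  refine word_mul_word_of_not_anti ?_
  rintro (u | f) h
  · obtain ⟨rfl | rfl, h | h⟩ := mem_of_anti_inl h <;> contradiction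
  · obtain ⟨e₁, e₂, h⟩ := hasVertex_of_anti_inr h
    obtain ⟨k, hk⟩ := exists_along d.adj
    obtain ⟨l, hl⟩ := exists_along d'.adj
    rw [hk.dir_eq, hl.dir_eq] at h
    rcases Face.common_vertex hk hl h e₁.1 e₁.2 e₂.1 e₂.2 with h | h | h | h <;> contradiction

/-- Exactly one qubit contributes a sign. Collinear edges carry `X` and `Y` at the common vertex and
equal matrices on any shared face qubit. Perpendicular edges span a face `f`: if it is even, the
vertex contributes the sign; if it is odd, the vertex labels agree and the qubit of `f` sees two
different directions. -/
theorem word_edge_mul_word_edge_of_snd_eq (hn : ∀ k, 0 < n k) {d d' : (graph n).Dart}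
    (h : d.snd = d'.fst) (h' : d.fst ≠ d'.snd) :
    word (edgeLabel o d) * word (edgeLabel o d') =
      -(word (edgeLabel o d') * word (edgeLabel o d)) := by
  obtain ⟨k, hk⟩ := exists_along d.adj
  obtain ⟨l, hl⟩ := exists_along d'.adj
  have inl (x : Vertex n) (hx : x ≠ d.snd) :
      ¬ Anti (edgeLabel o d (.inl x)) (edgeLabel o d' (.inl x)) := by
    intro hx'
    obtain ⟨rfl | rfl, h₂ | h₂⟩ := mem_of_anti_inl hx'
    · exact hx (h₂.trans h.symm)
    · exact h' h₂
    · exact hx rfl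
    · exact hx rfl
  have mid : edgeLabel o d' (.inl d.snd) = some (if o.pointsTo d'.fst d'.snd then 0 else 1) := by
    rw [h, edgeLabel_fst]
  have hl' : Along l d.snd d'.snd := h ▸ hl
  by_cases hkl : k = l
  · subst hkl
    have hcol : o.pointsTo d.fst d.snd = o.pointsTo d'.fst d'.snd := by
      rw [← h]; exact o.pointsTo_collinear hn hk hl' h'
    refine word_mul_word_of_anti (.inl d.snd) ?_ ?_
    · rw [mid, edgeLabel_snd, hcol]
      refine ⟨by simp, by simp, ?_⟩
      split_ifs <;> simp
    · rintro (x | f) hx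
      · exact inl x fun e => hx (e ▸ rfl)
      · intro hf
        obtain ⟨-, -, hne⟩ := hasVertex_of_anti_inr hf
        exact hne (hk.dir_eq.trans hl.dir_eq.symm)
  · obtain ⟨f, f₁, f₂, f₃⟩ := Face.exists_hasVertex hk hl' hkl
    have hodd := o.odd_iff hk.adj hl'.adj h' f₁ f₂ f₃
    rw [o.pointsTo_symm _ _ d.adj] at hodd
    have uniq (g : OddFace o)
        (hg : Anti (edgeLabel o d (.inr g)) (edgeLabel o d' (.inr g))) : g.1 = f := by
      obtain ⟨e₁, e₂, -⟩ := hasVertex_of_anti_inr hg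
      exact Face.eq_of_hasVertex hk hl' hkl e₁.1 e₁.2 e₂.2 f₁ f₂ f₃
    by_cases hf : IsOddFace o.pointsTo f
    · refine word_mul_word_of_anti (.inr ⟨f, hf⟩) ?_ ?_
      · rw [edgeLabel_inr, edgeLabel_inr, if_pos ⟨f₁, f₂⟩, if_pos ⟨h ▸ f₂, f₃⟩, hk.dir_eq,
          hl.dir_eq]
        exact ⟨by simp, by simp, by simpa using hkl⟩
      · rintro (x | g) hx
        · by_cases hxd : x = d.snd
          · rw [hxd, mid, edgeLabel_snd, ← h, ← hodd.1 hf]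
            rintro ⟨-, -, hne⟩
            cases h₁ : o.pointsTo d.fst d.snd <;> simp [h₁] at hne
          · exact inl x hxd
        · intro hg
          exact hx (congrArg Sum.inr (Subtype.ext (uniq g hg)))
    · refine word_mul_word_of_anti (.inl d.snd) ?_ ?_
      · rw [mid, edgeLabel_snd]
        rw [hodd, h] at hf
        refine ⟨by simp, by simp, ?_⟩
        rw [← h]
        cases h₁ : o.pointsTo d.fst d.snd <;> cases h₂ : o.pointsTo d.snd d'.snd <;>
          simp_all
      · rintro (x | g) hx
        · exact inl x fun e => hx (e ▸ rfl)
        · exact fun hg => hf (uniq g hg ▸ g.2)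

theorem word_edge_mul_word_vertex {d : (graph n).Dart} {x : Vertex n} (h₁ : x ≠ d.fst)
    (h₂ : x ≠ d.snd) :
    word (edgeLabel o d) * word (vertexLabel o x) =
      word (vertexLabel o x) * word (edgeLabel o d) := by
  refine word_mul_word_of_not_anti fun q hq => ?_
  by_cases h : q = .inl x
  · subst h; exact hq.1 (edgeLabel_inl_of_ne o h₁ h₂)
  · exact hq.2.1 (if_neg h)

theorem word_edge_mul_word_vertex_snd (d : (graph n).Dart) :
    word (edgeLabel o d) * word (vertexLabel o d.snd) =
      -(word (vertexLabel o d.snd) * word (edgeLabel o d)) := by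
  refine word_mul_word_of_anti (.inl d.snd) ?_ fun q hq h => h.2.1 (if_neg hq)
  rw [edgeLabel_snd, vertexLabel, if_pos rfl]
  refine ⟨by simp, by simp, ?_⟩
  split_ifs <;> simp

theorem word_vertex_mul_word_vertex (x y : Vertex n) :
    word (vertexLabel o x) * word (vertexLabel o y) =
      word (vertexLabel o y) * word (vertexLabel o x) := by
  refine word_mul_word_of_not_anti fun q h => ?_
  obtain ⟨h₁, h₂, h₃⟩ := h
  unfold vertexLabel at h₁ h₂ h₃
  split_ifs at h₁ h₂ h₃ <;> simp_all

end Labels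

/-! ### Existence of the representation -/

section Encoding

variable (o : Orientation n) (χ : EdgeChoice o)

/-- The sign that compares the direction of a directed edge with the orientation. -/
def directionSign (d : (graph n).Dart) : ℂ := if o.pointsTo d.fst d.snd then 1 else -1

open Classical in
/-- The sign of the edges chosen for the isolated odd faces. -/
noncomputable def choiceSign (d : (graph n).Dart) : ℂ :=
  if ∃ f, (χ.edge f).edge = d.edge then -1 else 1

/-- Only `directionSign` depends on the direction of the dart; the Pauli word and `choiceSign`
belong to the undirected edge. -/
theorem edgeOp_eq (d : (graph n).Dart) :
    edgeOp o χ d = (directionSign o d * choiceSign o χ d) • word (edgeLabel o d) := by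
  have forward (d : (graph n).Dart) (h : o.pointsTo d.fst d.snd = true) :
      forwardOp o χ d = choiceSign o χ d • word (edgeLabel o d) := by
    -- Chosen edges are recorded along the orientation, so no chosen dart is the reverse of the
    -- forward dart `d`.
    have hiff : (∃ f, χ.edge f = d) ↔ ∃ f, (χ.edge f).edge = d.edge := by
      refine exists_congr fun f => ⟨fun h => h ▸ rfl, fun hf => ?_⟩
      rcases (SimpleGraph.dart_edge_eq_iff _ _).1 hf with h' | h'
      · exact h'
      · have hp := χ.pointsTo f
        rw [h'] at hp
        have hs := o.pointsTo_symm d.fst d.snd d.adj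
        change o.pointsTo d.snd d.fst = true at hp
        rw [hp, h] at hs
        cases hs
    unfold forwardOp choiceSign
    rw [rawEdgeOp_eq, edgeLabel, if_pos h]
    simp only [hiff]
    split_ifs <;> simp
  unfold edgeOp directionSign
  by_cases h : o.pointsTo d.fst d.snd = true
  · rw [if_pos h, if_pos h, one_mul, forward d h]
  · have hs : o.pointsTo d.symm.fst d.symm.snd = true := by
      change o.pointsTo d.snd d.fst = true
      rw [o.pointsTo_symm d.fst d.snd d.adj]
      simpa using h
    have hc : choiceSign o χ d.symm = choiceSign o χ d := by
      unfold choiceSign; rw [SimpleGraph.Dart.edge_symm]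
    rw [if_neg h, if_neg h, forward _ hs, edgeLabel_symm, hc, neg_mul, one_mul, neg_smul]

theorem directionSign_mul_self (d : (graph n).Dart) :
    directionSign o d * directionSign o d = 1 := by
  unfold directionSign; split_ifs <;> simp

theorem choiceSign_mul_self (d : (graph n).Dart) :
    choiceSign o χ d * choiceSign o χ d = 1 := by
  unfold choiceSign; split_ifs <;> simp

theorem edgeOp_mul_self (d : (graph n).Dart) : edgeOp o χ d * edgeOp o χ d = 1 := by
  rw [edgeOp_eq, smul_mul_smul_comm, word_mul_self, mul_mul_mul_comm, directionSign_mul_self,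
    choiceSign_mul_self, mul_one, one_smul]

theorem vertexOp_mul_self (v : Vertex n) : vertexOp o v * vertexOp o v = 1 := by
  rw [vertexOp_eq, word_mul_self]

theorem edgeOp_symm (d : (graph n).Dart) : edgeOp o χ d = -edgeOp o χ d.symm := by
  have h : directionSign o d.symm = -directionSign o d := by
    have h := o.pointsTo_symm d.fst d.snd d.adj
    unfold directionSign
    change (if o.pointsTo d.snd d.fst then (1 : ℂ) else -1) = _
    cases h' : o.pointsTo d.fst d.snd <;> simp [h, h']
  rw [edgeOp_eq, edgeOp_eq, edgeLabel_symm, h, ← neg_smul, neg_mul, neg_neg]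
  unfold choiceSign
  rw [SimpleGraph.Dart.edge_symm]

theorem phaseOp_mul : (Complex.I • (1 : Op o)) * (-Complex.I • (1 : Op o)) = 1 := by
  rw [smul_mul_smul_comm]; simp

/-- The images of the generators, as invertible operators. -/
noncomputable def genUnit : MGen (graph n) → (Op o)ˣ
  | .phase => ⟨Complex.I • 1, -Complex.I • 1, phaseOp_mul o, by
      rw [smul_mul_smul_comm]; simp⟩
  | .vert v => ⟨vertexOp o v, vertexOp o v, vertexOp_mul_self o v, vertexOp_mul_self o v⟩
  | .edge d => ⟨edgeOp o χ d, edgeOp o χ d, edgeOp_mul_self o χ d, edgeOp_mul_self o χ d⟩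

theorem exists_encoding (hn : ∀ k, 0 < n k) :
    ∃ σ : MGroup (graph n) →* Op o, IsEncoding o χ σ := by
  have hI : ((genUnit o χ .phase : (Op o)ˣ) : Op o) = Complex.I • 1 := rfl
  have hI2 : ((genUnit o χ .phase : (Op o)ˣ) : Op o) ^ 2 = -1 := by
    rw [hI, smul_pow, one_pow, Complex.I_sq, neg_smul, one_smul]
  have hv (v) : ((genUnit o χ (.vert v) : (Op o)ˣ) : Op o) = vertexOp o v := rfl
  have he (d) : ((genUnit o χ (.edge d) : (Op o)ˣ) : Op o) = edgeOp o χ d := rfl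
  have rel (a b : FreeGroup (MGen (graph n))) (h : MRel (graph n) a b) :
      FreeGroup.lift (genUnit o χ) a = FreeGroup.lift (genUnit o χ) b := by
    apply Units.ext
    cases h <;>
      simp only [MGen.I, MGen.v, MGen.e, map_mul, map_pow, FreeGroup.lift_apply_of, map_one,
        Units.val_mul, Units.val_pow_eq_pow_val, Units.val_one, hI2, hv, he, neg_mul, one_mul]
    case phase_order =>
      rw [show 4 = 2 * 2 from rfl, pow_mul, hI2]; simp
    case phase_central x => rw [hI]; simp
    case edge_sq d => rw [pow_two, edgeOp_mul_self]
    case vert_sq x => rw [pow_two, vertexOp_mul_self]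
    case edge_symm d => exact edgeOp_symm o χ d
    case vert_vert x y => rw [vertexOp_eq, vertexOp_eq, word_vertex_mul_word_vertex]
    case edge_vert_comm d x h₁ h₂ =>
      rw [edgeOp_eq, vertexOp_eq, smul_mul_assoc, mul_smul_comm,
        word_edge_mul_word_vertex h₁ h₂]
    case edge_edge_comm d d' h₁ h₂ h₃ h₄ =>
      rw [edgeOp_eq, edgeOp_eq, smul_mul_smul_comm, smul_mul_smul_comm,
        word_edge_mul_word_edge h₁ h₂ h₃ h₄, mul_comm]
    case edge_vert_anti d =>
      rw [edgeOp_eq, vertexOp_eq, smul_mul_assoc, mul_smul_comm,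
        word_edge_mul_word_vertex_snd, smul_neg]
    case edge_edge_anti d d' h h' =>
      rw [edgeOp_eq, edgeOp_eq, smul_mul_smul_comm, smul_mul_smul_comm,
        word_edge_mul_word_edge_of_snd_eq hn h h', smul_neg, mul_comm]
  refine ⟨(Units.coeHom (Op o)).comp (MGroup.lift (genUnit o χ) rel), ?_, fun v => ?_,
    fun d => ?_⟩ <;>
    simp only [MonoidHom.comp_apply, MGroup.I, MGroup.vert, MGroup.edge, MGroup.lift_of] <;> rfl

end Encoding

end Cubic

/-! ### The cycle around a face -/

namespace Cubic

open Pauli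

variable {n : Fin 3 → ℕ}

namespace Face

/-- The four vertices of a face. -/
def pt (f : Face n) (s t : Fin 2) : Vertex n := fun j =>
  ⟨f.corner j + if j = f.axis + 1 then s else if j = f.axis + 2 then t else 0, by
    have h₁ := f.lt (f.axis + 1) (by simp)
    have h₂ := f.lt (f.axis + 2) (by simp)
    have h₃ := (f.corner j).isLt
    split_ifs with hj hj
    · subst hj; omega
    · subst hj; omega
    · omega⟩

theorem pt_axis (f : Face n) (s t : Fin 2) : (f.pt s t f.axis : ℕ) = f.corner f.axis := by
  simp [pt]

theorem pt_axis_add_one (f : Face n) (s t : Fin 2) :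
    (f.pt s t (f.axis + 1) : ℕ) = f.corner (f.axis + 1) + s := by
  simp [pt]

theorem pt_axis_add_two (f : Face n) (s t : Fin 2) :
    (f.pt s t (f.axis + 2) : ℕ) = f.corner (f.axis + 2) + t := by
  simp [pt]

theorem eq_axis_or (a j : Fin 3) : j = a ∨ j = a + 1 ∨ j = a + 2 := by
  revert a j; decide

theorem along_pt_left (f : Face n) (t : Fin 2) : Along (f.axis + 1) (f.pt 0 t) (f.pt 1 t) := by
  refine ⟨.inl (by simp [pt_axis_add_one]), fun j hj => ?_⟩
  rcases eq_axis_or f.axis j with rfl | rfl | rfl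
  · rw [pt_axis, pt_axis]
  · exact absurd rfl hj
  · rw [pt_axis_add_two, pt_axis_add_two]

theorem along_pt_right (f : Face n) (s : Fin 2) : Along (f.axis + 2) (f.pt s 0) (f.pt s 1) := by
  refine ⟨.inl (by simp [pt_axis_add_two]), fun j hj => ?_⟩
  rcases eq_axis_or f.axis j with rfl | rfl | rfl
  · rw [pt_axis, pt_axis]
  · rw [pt_axis_add_one, pt_axis_add_one]
  · exact absurd rfl hj

theorem pt_inj {f : Face n} {s t s' t' : Fin 2} : f.pt s t = f.pt s' t' ↔ s = s' ∧ t = t' := by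
  refine ⟨fun h => ?_, fun h => by rw [h.1, h.2]⟩
  have h₁ := f.pt_axis_add_one s t
  have h₂ := f.pt_axis_add_two s t
  rw [h, pt_axis_add_one] at h₁
  rw [h, pt_axis_add_two] at h₂
  exact ⟨Fin.ext (by omega), Fin.ext (by omega)⟩

theorem hasVertex_pt (f : Face n) (s t : Fin 2) : f.HasVertex (f.pt s t) := by
  refine ⟨Fin.ext (f.pt_axis s t), fun j hj => ?_⟩
  rcases eq_axis_or f.axis j with rfl | rfl | rfl
  · exact absurd rfl hj
  · rw [pt_axis_add_one]; omega
  · rw [pt_axis_add_two]; omega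

theorem exists_eq_pt {f : Face n} {w : Vertex n} (h : f.HasVertex w) :
    ∃ s t, w = f.pt s t := by
  have h₁ := h.2 (f.axis + 1) (by simp)
  have h₂ := h.2 (f.axis + 2) (by simp)
  refine ⟨⟨w (f.axis + 1) - f.corner (f.axis + 1), by omega⟩,
    ⟨w (f.axis + 2) - f.corner (f.axis + 2), by omega⟩, vertex_ext fun j => ?_⟩
  rcases eq_axis_or f.axis j with rfl | rfl | rfl
  · rw [pt_axis, h.axis_val]
  · rw [pt_axis_add_one]; simp only; omega
  · rw [pt_axis_add_two]; simp only; omega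

/-- The first side of a face on the walk around it. -/
def bottom (f : Face n) : (graph n).Dart := ⟨(f.pt 0 0, f.pt 1 0), (f.along_pt_left 0).adj⟩

/-- The second side of a face on the walk around it. -/
def right (f : Face n) : (graph n).Dart := ⟨(f.pt 1 0, f.pt 1 1), (f.along_pt_right 1).adj⟩

/-- The third side of a face on the walk around it. -/
def top (f : Face n) : (graph n).Dart := ⟨(f.pt 1 1, f.pt 0 1), (f.along_pt_left 1).symm.adj⟩

/-- The fourth side of a face on the walk around it. -/
def left (f : Face n) : (graph n).Dart := ⟨(f.pt 0 1, f.pt 0 0), (f.along_pt_right 0).symm.adj⟩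

theorem darts_walk (f : Face n) : f.walk.darts = [f.bottom, f.right, f.top, f.left] := by
  have h₁ := f.lt (f.axis + 1) (by simp)
  have h₂ := f.lt (f.axis + 2) (by simp)
  have h₃ : (up f.corner (f.axis + 1) h₁ (f.axis + 2) : ℕ) < n (f.axis + 2) := by
    simpa [up] using h₂
  have e₀ : f.corner = f.pt 0 0 := vertex_ext fun j => by simp [pt]
  have e₁ : up f.corner (f.axis + 1) h₁ = f.pt 1 0 := vertex_ext fun j => by
    rcases eq_axis_or f.axis j with rfl | rfl | rfl <;> simp [up, pt]
  have e₂ : up (up f.corner (f.axis + 1) h₁) (f.axis + 2) h₃ = f.pt 1 1 :=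
    vertex_ext fun j => by
      rcases eq_axis_or f.axis j with rfl | rfl | rfl <;> simp [up, pt]
  have e₃ : up f.corner (f.axis + 2) h₂ = f.pt 0 1 := vertex_ext fun j => by
    rcases eq_axis_or f.axis j with rfl | rfl | rfl <;> simp [up, pt]
  have ext {d d' : (graph n).Dart} {l l' : List (graph n).Dart} (h₁ : d.fst = d'.fst)
      (h₂ : d.snd = d'.snd) (h : l = l') : d :: l = d' :: l' := by
    rw [SimpleGraph.Dart.ext _ _ (Prod.ext h₁ h₂), h]
  exact ext e₀ e₁ (ext e₁ e₂ (ext e₂ e₃ (ext e₃ e₀ rfl)))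

/-- Both ends of the edge are vertices of the face. -/
def HasDart (f : Face n) (d : (graph n).Dart) : Prop := f.HasVertex d.fst ∧ f.HasVertex d.snd

instance (f : Face n) (d : (graph n).Dart) : Decidable (f.HasDart d) :=
  inferInstanceAs (Decidable (_ ∧ _))

theorem HasDart.congr {f : Face n} {d d' : (graph n).Dart} (h : d.edge = d'.edge)
    (hd : f.HasDart d) : f.HasDart d' := by
  rcases (SimpleGraph.dart_edge_eq_iff _ _).1 h with rfl | rfl
  · exact hd
  · exact ⟨hd.2, hd.1⟩

theorem hasDart_bottom (f : Face n) : f.HasDart f.bottom := ⟨hasVertex_pt _ _ _, hasVertex_pt _ _ _⟩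

theorem hasDart_right (f : Face n) : f.HasDart f.right := ⟨hasVertex_pt _ _ _, hasVertex_pt _ _ _⟩

theorem hasDart_top (f : Face n) : f.HasDart f.top := ⟨hasVertex_pt _ _ _, hasVertex_pt _ _ _⟩

theorem hasDart_left (f : Face n) : f.HasDart f.left := ⟨hasVertex_pt _ _ _, hasVertex_pt _ _ _⟩

theorem edge_eq_of_hasDart {f : Face n} {d : (graph n).Dart} (h : f.HasDart d) :
    f.bottom.edge = d.edge ∨ f.right.edge = d.edge ∨ f.top.edge = d.edge ∨
      f.left.edge = d.edge := by
  obtain ⟨s, t, h₁⟩ := exists_eq_pt h.1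
  obtain ⟨s', t', h₂⟩ := exists_eq_pt h.2
  obtain ⟨k, hk⟩ := exists_along d.adj
  have hne := ne_axis h.1 h.2 hk
  have hd : d.edge = s(f.pt s t, f.pt s' t') := by rw [← h₁, ← h₂]; rfl
  rw [h₁, h₂] at hk
  rw [hd]
  change s(_, _) = _ ∨ s(_, _) = _ ∨ s(_, _) = _ ∨ s(_, _) = _
  simp only [bottom, right, top, left, Sym2.eq_iff, pt_inj]
  rcases eq_axis_or f.axis k with rfl | rfl | rfl
  · exact absurd rfl hne
  · have a := hk.1
    have b := hk.2 (f.axis + 2) (by simp)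
    simp only [pt_axis_add_one, pt_axis_add_two] at a b
    have ht : t = t' := Fin.ext (by omega)
    have hs : s ≠ s' := fun e => by subst e; omega
    subst ht
    clear a b hk hd h₁ h₂
    fin_cases s <;> fin_cases s' <;> fin_cases t <;> simp at hs ⊢
  · have a := hk.1
    have b := hk.2 (f.axis + 1) (by simp)
    simp only [pt_axis_add_one, pt_axis_add_two] at a b
    have hs : s = s' := Fin.ext (by omega)
    have ht : t ≠ t' := fun e => by subst e; omega
    subst hs
    clear a b hk hd h₁ h₂
    fin_cases s <;> fin_cases t <;> fin_cases t' <;> simp at ht ⊢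

theorem bottom_ne_right (f : Face n) : f.bottom.edge ≠ f.right.edge := by
  simp [bottom, right, SimpleGraph.Dart.edge, pt_inj]

theorem bottom_ne_top (f : Face n) : f.bottom.edge ≠ f.top.edge := by
  simp [bottom, top, SimpleGraph.Dart.edge, pt_inj]

theorem bottom_ne_left (f : Face n) : f.bottom.edge ≠ f.left.edge := by
  simp [bottom, left, SimpleGraph.Dart.edge, pt_inj]

theorem right_ne_top (f : Face n) : f.right.edge ≠ f.top.edge := by
  simp [right, top, SimpleGraph.Dart.edge, pt_inj]

theorem right_ne_left (f : Face n) : f.right.edge ≠ f.left.edge := by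
  simp [right, left, SimpleGraph.Dart.edge, pt_inj]

theorem top_ne_left (f : Face n) : f.top.edge ≠ f.left.edge := by
  simp [top, left, SimpleGraph.Dart.edge, pt_inj]

end Face

theorem faceCycle_eq (f : Face n) :
    faceCycle f = MGroup.edge _ f.bottom * (MGroup.edge _ f.right *
      (MGroup.edge _ f.top * MGroup.edge _ f.left)) := by
  have hlen : f.walk.length = 4 := by
    rw [← SimpleGraph.Walk.length_darts, Face.darts_walk]; rfl
  rw [faceCycle, MGroup.ofWalk, hlen, MGroup.I_pow_four, Face.darts_walk]
  simp

theorem faceCycle_mem_cycles (f : Face n) : faceCycle f ∈ MGroup.cycles (graph n) :=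
  Subgroup.subset_closure ⟨_, _, rfl⟩

open Classical in
theorem edgeContent_faceCycle (f : Face n) (d : (graph n).Dart) :
    (faceCycle f).edgeContent d = if f.HasDart d then 1 else 0 := by
  rw [faceCycle_eq]
  simp only [MGroup.edgeContent_mul, MGroup.edgeContent_edge]
  by_cases h : f.HasDart d
  · rcases Face.edge_eq_of_hasDart h with h' | h' | h' | h' <;>
      simp [← h', h, f.bottom_ne_right, f.bottom_ne_top, f.bottom_ne_left, f.right_ne_top,
        f.right_ne_left, f.top_ne_left, f.bottom_ne_right.symm, f.bottom_ne_top.symm,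
        f.bottom_ne_left.symm, f.right_ne_top.symm, f.right_ne_left.symm, f.top_ne_left.symm]
  · rw [if_neg h, if_neg fun h' => h (f.hasDart_bottom.congr h'),
      if_neg fun h' => h (f.hasDart_right.congr h'), if_neg fun h' => h (f.hasDart_top.congr h'),
      if_neg fun h' => h (f.hasDart_left.congr h')]
    simp

/-! ### The operator of the cycle around an odd face -/

section Operators

variable {o : Orientation n} (χ : EdgeChoice o)

/-- Consecutive sides of an odd face meet head to head or tail to tail, so they carry the same
matrix at the common vertex while a walk traverses one along and one against the orientation. -/
theorem edgeLabel_eq_of_odd {f : Face n} (hf : IsOddFace o.pointsTo f) {d d' : (graph n).Dart}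
    (hd : f.HasDart d) (hd' : f.HasDart d') (h : d.snd = d'.fst) (h' : d.fst ≠ d'.snd) :
    edgeLabel o d (.inl d.snd) = edgeLabel o d' (.inl d.snd) ∧
      directionSign o d' = -directionSign o d := by
  have key : o.pointsTo d.fst d.snd = !o.pointsTo d'.fst d'.snd := by
    rw [← o.pointsTo_symm _ _ d'.adj, ← h]
    exact hf _ _ _ hd.1 hd.2 hd'.2 d.adj (h ▸ d'.adj) h'
  constructor
  · have e : edgeLabel o d' (.inl d.snd) = some (if o.pointsTo d'.fst d'.snd then 0 else 1) := by
      rw [h, edgeLabel_fst]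
    rw [e, edgeLabel_snd, key]
    cases o.pointsTo d'.fst d'.snd <;> simp
  · rw [directionSign, directionSign, key]
    cases o.pointsTo d'.fst d'.snd <;> simp

/-- The operator of the cycle around an odd face on each qubit, up to sign. -/
noncomputable def faceFactor (o : Orientation n) (f : Face n) (q : Qubit o) :
    Matrix (Fin 2) (Fin 2) ℂ :=
  opt (edgeLabel o f.bottom q) * (opt (edgeLabel o f.right q) *
    (opt (edgeLabel o f.top q) * opt (edgeLabel o f.left q)))

theorem map_faceCycle {σ : MGroup (graph n) →* Op o} (hσ : IsEncoding o χ σ) {f : Face n}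
    (hf : IsOddFace o.pointsTo f) :
    σ (faceCycle f) = (choiceSign o χ f.bottom * (choiceSign o χ f.right *
      (choiceSign o χ f.top * choiceSign o χ f.left))) • tensor (faceFactor o f) := by
  have h₁ := (edgeLabel_eq_of_odd hf f.hasDart_bottom f.hasDart_right rfl
    (by simp [Face.bottom, Face.right, Face.pt_inj])).2
  have h₂ := (edgeLabel_eq_of_odd hf f.hasDart_right f.hasDart_top rfl
    (by simp [Face.top, Face.right, Face.pt_inj])).2
  have h₃ := (edgeLabel_eq_of_odd hf f.hasDart_top f.hasDart_left rfl
    (by simp [Face.top, Face.left, Face.pt_inj])).2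
  have hs := directionSign_mul_self o f.bottom
  rw [faceCycle_eq]
  simp only [map_mul, hσ.edge, edgeOp_eq, smul_mul_smul_comm]
  refine congrArg₂ (· • ·) ?_ ?_
  · rw [h₃, h₂, h₁]
    -- The direction signs alternate as s, -s, s, -s, so their product is s⁴; the factor s² + 1
    -- comes from s⁴ - 1 = (s² + 1)(s² - 1).
    linear_combination (choiceSign o χ f.bottom * choiceSign o χ f.right * choiceSign o χ f.top *
      choiceSign o χ f.left) * (directionSign o f.bottom ^ 2 + 1) * hs
  · simp only [word, tensor_mul]
    rfl

/-- At each vertex of the face exactly two sides act, with the same Pauli matrix, which squares to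
1. -/
theorem faceFactor_inl {f : Face n} (hf : IsOddFace o.pointsTo f) (u : Vertex n) :
    faceFactor o f (.inl u) = 1 := by
  have h₁ := (edgeLabel_eq_of_odd hf f.hasDart_bottom f.hasDart_right rfl
    (by simp [Face.bottom, Face.right, Face.pt_inj])).1
  have h₂ := (edgeLabel_eq_of_odd hf f.hasDart_right f.hasDart_top rfl
    (by simp [Face.top, Face.right, Face.pt_inj])).1
  have h₃ := (edgeLabel_eq_of_odd hf f.hasDart_top f.hasDart_left rfl
    (by simp [Face.top, Face.left, Face.pt_inj])).1
  have h₄ := (edgeLabel_eq_of_odd hf f.hasDart_left f.hasDart_bottom rfl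
    (by simp [Face.left, Face.bottom, Face.pt_inj])).1
  unfold faceFactor
  have none {d : (graph n).Dart} (h : u ≠ d.fst ∧ u ≠ d.snd) :
      opt (edgeLabel o d (.inl u)) = 1 := by
    rw [edgeLabel_inl_of_ne o h.1 h.2]; rfl
  by_cases c₁ : u = f.pt 1 0
  · subst c₁
    rw [none (d := f.top) (by simp [Face.top, Face.pt_inj]),
      none (d := f.left) (by simp [Face.left, Face.pt_inj]), mul_one, mul_one]
    exact (congrArg (fun x => opt x * _) h₁).trans (opt_mul_self _)
  by_cases c₂ : u = f.pt 1 1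
  · subst c₂
    rw [none (d := f.bottom) (by simp [Face.bottom, Face.pt_inj]),
      none (d := f.left) (by simp [Face.left, Face.pt_inj]), mul_one, one_mul]
    exact (congrArg (fun x => opt x * _) h₂).trans (opt_mul_self _)
  by_cases c₃ : u = f.pt 0 1
  · subst c₃
    rw [none (d := f.bottom) (by simp [Face.bottom, Face.pt_inj]),
      none (d := f.right) (by simp [Face.right, Face.pt_inj]), one_mul, one_mul]
    exact (congrArg (fun x => opt x * _) h₃).trans (opt_mul_self _)
  by_cases c₄ : u = f.pt 0 0
  · subst c₄
    rw [none (d := f.right) (by simp [Face.right, Face.pt_inj]),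
      none (d := f.top) (by simp [Face.top, Face.pt_inj]), one_mul, one_mul]
    exact (congrArg (fun x => _ * opt x) h₄).trans (opt_mul_self _)
  rw [none (d := f.bottom) ⟨c₄, c₁⟩, none (d := f.right) ⟨c₁, c₂⟩, none (d := f.top) ⟨c₂, c₃⟩,
    none (d := f.left) ⟨c₃, c₄⟩]
  simp

theorem faceFactor_inr (f : Face n) (g : OddFace o) :
    faceFactor o f (.inr g) =
      opt (if g.1.HasDart f.bottom then some (f.axis + 1) else none) *
        (opt (if g.1.HasDart f.right then some (f.axis + 2) else none) *
        (opt (if g.1.HasDart f.top then some (f.axis + 1) else none) *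
          opt (if g.1.HasDart f.left then some (f.axis + 2) else none))) := by
  have e₁ : dir f.bottom.fst f.bottom.snd = f.axis + 1 := (f.along_pt_left 0).dir_eq
  have e₂ : dir f.right.fst f.right.snd = f.axis + 2 := (f.along_pt_right 1).dir_eq
  have e₃ : dir f.top.fst f.top.snd = f.axis + 1 := (f.along_pt_left 1).symm.dir_eq
  have e₄ : dir f.left.fst f.left.snd = f.axis + 2 := (f.along_pt_right 0).symm.dir_eq
  simp only [faceFactor, edgeLabel_inr, e₁, e₂, e₃, e₄]
  rfl

/-- The sides contribute PQPQ with P and Q anticommuting. This is the sign to be corrected by a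
chosen edge or by an opposite face. -/
theorem faceFactor_self {f : Face n} (hf : IsOddFace o.pointsTo f) :
    faceFactor o f (.inr ⟨f, hf⟩) = -1 := by
  rw [faceFactor_inr, if_pos f.hasDart_bottom, if_pos f.hasDart_right, if_pos f.hasDart_top,
    if_pos f.hasDart_left]
  change mat _ * (mat _ * (mat _ * mat _)) = -1
  rw [← mul_assoc (mat (f.axis + 2)), mat_mul_mat (show f.axis + 2 ≠ f.axis + 1 by simp), neg_mul,
    mul_assoc, mat_mul_self, mul_one, mul_neg, mat_mul_self]

theorem faceFactor_eq_one {f : Face n} {g : OddFace o}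
    (h : ∀ d, f.HasDart d → ¬ g.1.HasDart d) : faceFactor o f (.inr g) = 1 := by
  rw [faceFactor_inr, if_neg (h _ f.hasDart_bottom), if_neg (h _ f.hasDart_right),
    if_neg (h _ f.hasDart_top), if_neg (h _ f.hasDart_left)]
  simp [opt]

/-- A different face contains at most one side of a face. -/
theorem faceFactor_mul_self {f : Face n} {g : OddFace o} (hfg : g.1 ≠ f) :
    faceFactor o f (.inr g) * faceFactor o f (.inr g) = 1 := by
  have hne : f.axis + 1 ≠ f.axis + 2 := by simp
  have t₁ (h₁ : g.1.HasDart f.bottom) (h₂ : g.1.HasDart f.right) : False :=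
    hfg (Face.eq_of_hasVertex (f.along_pt_left 0) (f.along_pt_right 1) hne h₁.1 h₁.2 h₂.2
      (f.hasVertex_pt _ _) (f.hasVertex_pt _ _) (f.hasVertex_pt _ _))
  have t₂ (h₁ : g.1.HasDart f.top) (h₂ : g.1.HasDart f.right) : False :=
    hfg (Face.eq_of_hasVertex (f.along_pt_left 1) (f.along_pt_right 1).symm hne h₁.2 h₁.1 h₂.1
      (f.hasVertex_pt _ _) (f.hasVertex_pt _ _) (f.hasVertex_pt _ _))
  have t₃ (h₁ : g.1.HasDart f.top) (h₂ : g.1.HasDart f.left) : False :=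
    hfg (Face.eq_of_hasVertex (f.along_pt_left 1).symm (f.along_pt_right 0).symm hne h₁.1 h₁.2 h₂.2
      (f.hasVertex_pt _ _) (f.hasVertex_pt _ _) (f.hasVertex_pt _ _))
  have t₄ (h₁ : g.1.HasDart f.bottom) (h₂ : g.1.HasDart f.left) : False :=
    hfg (Face.eq_of_hasVertex (f.along_pt_left 0).symm (f.along_pt_right 0) hne h₁.2 h₁.1 h₂.1
      (f.hasVertex_pt _ _) (f.hasVertex_pt _ _) (f.hasVertex_pt _ _))
  have t₅ (h₁ : g.1.HasDart f.bottom) (h₂ : g.1.HasDart f.top) : False :=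
    t₁ h₁ ⟨h₁.2, h₂.1⟩
  have t₆ (h₁ : g.1.HasDart f.left) (h₂ : g.1.HasDart f.right) : False :=
    t₁ ⟨h₁.2, h₂.1⟩ h₂
  rw [faceFactor_inr]
  by_cases h₁ : g.1.HasDart f.bottom <;> by_cases h₂ : g.1.HasDart f.right <;>
    by_cases h₃ : g.1.HasDart f.top <;> by_cases h₄ : g.1.HasDart f.left <;>
    first
    | exact (t₁ h₁ h₂).elim
    | exact (t₂ h₃ h₂).elim
    | exact (t₃ h₃ h₄).elim
    | exact (t₄ h₁ h₄).elim
    | exact (t₅ h₁ h₃).elim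
    | exact (t₆ h₄ h₂).elim
    | simp [h₁, h₂, h₃, h₄, opt, mat_mul_self]

/-! ### The kernel contains the generators -/

/-- Two signs cancel: the -1 on the qubit of the face, and the one from its chosen edge. No other
odd face contains a side of `f`, so there is neither another qubit nor another chosen side. -/
theorem map_faceCycle_of_isolated {σ : MGroup (graph n) →* Op o} (hσ : IsEncoding o χ σ)
    {a : Fin 3 → ℕ} (ha : IsParity o a) {f : Face n} (hf : IsIsolatedOddFace o f) :
    σ (faceCycle f) = 1 := by
  classical
  have htensor : tensor (faceFactor o f) = -1 := by
    rw [← tensor_one]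
    refine tensor_eq_neg (.inr ⟨f, hf.1⟩) (faceFactor_self hf.1) ?_
    rintro (u | g) hg
    · exact faceFactor_inl hf.1 u
    · refine faceFactor_eq_one fun d hd hd' => hg (congrArg Sum.inr (Subtype.ext ?_))
      obtain ⟨k, hk⟩ := exists_along d.adj
      exact eq_of_isIsolatedOddFace ha hf g.2 hk hd.1 hd.2 hd'.1 hd'.2
  have hsign {d : (graph n).Dart} (hd : f.HasDart d) :
      choiceSign o χ d = if (χ.edge ⟨f, hf⟩).edge = d.edge then -1 else 1 := by
    unfold choiceSign
    congr 1
    refine propext ⟨fun ⟨g, hg⟩ => ?_, fun h => ⟨_, h⟩⟩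
    have hgd : g.1.HasDart d := Face.HasDart.congr hg (χ.mem g)
    obtain ⟨k, hk⟩ := exists_along d.adj
    have : g = ⟨f, hf⟩ := Subtype.ext
      (eq_of_isIsolatedOddFace ha hf g.2.1 hk hd.1 hd.2 hgd.1 hgd.2)
    rwa [← this]
  rw [map_faceCycle χ hσ hf.1, htensor, hsign f.hasDart_bottom, hsign f.hasDart_right,
    hsign f.hasDart_top, hsign f.hasDart_left]
  rcases Face.edge_eq_of_hasDart (χ.mem ⟨f, hf⟩) with h' | h' | h' | h' <;>
      simp [← h', f.bottom_ne_right, f.bottom_ne_top, f.bottom_ne_left, f.right_ne_top,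
        f.right_ne_left, f.top_ne_left, f.bottom_ne_right.symm, f.bottom_ne_top.symm,
        f.bottom_ne_left.symm, f.right_ne_top.symm, f.right_ne_left.symm, f.top_ne_left.symm]

/-- An isolated odd face containing an edge of an odd cell would be a face of that cell. -/
theorem choiceSign_of_isOddCell {a : Fin 3 → ℕ} (ha : IsParity o a) {c : Cell n}
    (hc : IsOddCell o c) {f : Face n} (hf : f.IsFaceOf c) {d : (graph n).Dart}
    (hd : f.HasDart d) : choiceSign o χ d = 1 := by
  refine if_neg fun ⟨g, hg⟩ => ?_
  have hgd : g.1.HasDart d := Face.HasDart.congr hg (χ.mem g)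
  obtain ⟨k, hk⟩ := exists_along d.adj
  exact g.2.2.2 c hc (isFaceOf_of_isOddCell ha hc g.2.1 hk
    ((Face.hasVertex_iff_of_isFaceOf hf).1 hd.1).1 ((Face.hasVertex_iff_of_isFaceOf hf).1 hd.2).1
    hgd.1 hgd.2)

theorem upper_pt (c : Cell n) (k : Fin 3) (s t : Fin 2) :
    ((c.upper k).pt s t k : ℕ) = c k + 1 ∧
      ∀ j, j ≠ k → ((c.upper k).pt s t j : ℕ) = (c.lower k).pt s t j := by
  refine ⟨((c.upper k).pt_axis s t).trans ?_, fun j hj => ?_⟩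
  · simp [Cell.upper]
  · simp [Face.pt, Cell.upper, Cell.lower, Function.update_of_ne hj]
    rfl

theorem lower_pt (c : Cell n) (k : Fin 3) (s t : Fin 2) : ((c.lower k).pt s t k : ℕ) = c k :=
  (c.lower k).pt_axis s t

/-- The faces of a cell other than `c.lower k` and `c.upper k` contain corresponding vertices of
these two. -/
theorem hasVertex_upper_pt_iff {c : Cell n} {k : Fin 3} {g : Face n} (hg : g.IsFaceOf c)
    (hk : g.axis ≠ k) (s t : Fin 2) :
    g.HasVertex ((c.upper k).pt s t) ↔ g.HasVertex ((c.lower k).pt s t) := by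
  have h₁ : (c.lower k).IsFaceOf c := ⟨k, .inl rfl⟩
  have h₂ : (c.upper k).IsFaceOf c := ⟨k, .inr rfl⟩
  have e₁ := ((Face.hasVertex_iff_of_isFaceOf h₁).1 ((c.lower k).hasVertex_pt s t)).1
  have e₂ := ((Face.hasVertex_iff_of_isFaceOf h₂).1 ((c.upper k).hasVertex_pt s t)).1
  rw [Face.hasVertex_iff_of_isFaceOf hg, Face.hasVertex_iff_of_isFaceOf hg,
    (upper_pt c k s t).2 _ hk]
  simp only [e₁, e₂]

theorem eq_lower_or_upper {c : Cell n} {g : Face n} (hg : g.IsFaceOf c) {k : Fin 3}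
    (hk : g.axis = k) : g = c.lower k ∨ g = c.upper k := by
  obtain ⟨l, rfl | rfl⟩ := hg
  · exact .inl (by rw [show l = k from hk])
  · exact .inr (by rw [show l = k from hk])

theorem lower_ne_upper (c : Cell n) (k : Fin 3) : c.lower k ≠ c.upper k := fun h => by
  have h₁ := lower_pt c k 0 0
  rw [h, (upper_pt c k 0 0).1] at h₁
  omega

theorem not_hasVertex_upper_of_lower {c : Cell n} {k : Fin 3} {w : Vertex n}
    (h : (c.lower k).HasVertex w) (h' : (c.upper k).HasVertex w) : False := by
  have h₁ := h.axis_val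
  have h₂ := h'.axis_val
  simp only [Cell.upper, Cell.lower, Function.update_self, Fin.val_castSucc, Fin.val_succ]
    at h₁ h₂
  omega

/-- Each of the two faces gives -1 on its own qubit, and on all other qubits the two factors
coincide and square to 1. -/
theorem map_pairCycle {σ : MGroup (graph n) →* Op o} (hσ : IsEncoding o χ σ)
    {a : Fin 3 → ℕ} (ha : IsParity o a) {c : Cell n} (hc : IsOddCell o c) (k : Fin 3) :
    σ (pairCycle c k) = 1 := by
  classical
  have fl : (c.lower k).IsFaceOf c := ⟨k, .inl rfl⟩
  have fu : (c.upper k).IsFaceOf c := ⟨k, .inr rfl⟩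
  have hl := hc _ fl
  have hu := hc _ fu
  have sl {d : (graph n).Dart} (hd : (c.lower k).HasDart d) :=
    choiceSign_of_isOddCell χ ha hc fl hd
  have su {d : (graph n).Dart} (hd : (c.upper k).HasDart d) :=
    choiceSign_of_isOddCell χ ha hc fu hd
  rw [pairCycle, map_mul, map_faceCycle χ hσ hl, map_faceCycle χ hσ hu,
    sl (Face.hasDart_bottom _), sl (Face.hasDart_right _), sl (Face.hasDart_top _),
    sl (Face.hasDart_left _), su (Face.hasDart_bottom _), su (Face.hasDart_right _),
    su (Face.hasDart_top _), su (Face.hasDart_left _), mul_one, mul_one, mul_one, one_smul,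
    one_smul, tensor_mul]
  have hll : faceFactor o (c.lower k) (.inr ⟨c.upper k, hu⟩) = 1 :=
    faceFactor_eq_one fun d hd hd' => not_hasVertex_upper_of_lower hd.1 hd'.1
  have huu : faceFactor o (c.upper k) (.inr ⟨c.lower k, hl⟩) = 1 :=
    faceFactor_eq_one fun d hd hd' => not_hasVertex_upper_of_lower hd'.1 hd.1
  have hdiff : (.inr ⟨c.upper k, hu⟩ : Qubit o) ≠ .inr ⟨c.lower k, hl⟩ := fun h =>
    lower_ne_upper c k (congrArg Subtype.val (Sum.inr.inj h)).symm
  -- Corresponding sides of the opposite faces are parallel and lie in the same side face of `c`; an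
  -- odd face that is not a face of `c` contains no edge of it.
  have side (g : OddFace o) (gl : g.1 ≠ c.lower k) (gu : g.1 ≠ c.upper k) :
      faceFactor o (c.upper k) (.inr g) = faceFactor o (c.lower k) (.inr g) := by
    have key (d d' : (graph n).Dart) (hd : (c.lower k).HasDart d) (hd' : (c.upper k).HasDart d')
        (h : g.1.IsFaceOf c → g.1.axis ≠ k → (g.1.HasDart d' ↔ g.1.HasDart d)) :
        g.1.HasDart d' ↔ g.1.HasDart d := by
      have hface {f : Face n} (hf : f.IsFaceOf c) {d : (graph n).Dart} (hd : f.HasDart d)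
          (hgd : g.1.HasDart d) : g.1.IsFaceOf c := by
        obtain ⟨k, hk⟩ := exists_along d.adj
        exact isFaceOf_of_isOddCell ha hc g.2 hk ((Face.hasVertex_iff_of_isFaceOf hf).1 hd.1).1
          ((Face.hasVertex_iff_of_isFaceOf hf).1 hd.2).1 hgd.1 hgd.2
      have hax (hg : g.1.IsFaceOf c) : g.1.axis ≠ k := fun e => by
        rcases eq_lower_or_upper hg e with h | h <;> contradiction
      constructor
      · intro h'
        have := hface fu hd' h'
        exact (h this (hax this)).1 h'
      · intro h'
        have := hface fl hd h'
        exact (h this (hax this)).2 h'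
    have pts (hg : g.1.IsFaceOf c) (hk : g.1.axis ≠ k) (s t s' t' : Fin 2) :=
      and_congr (hasVertex_upper_pt_iff hg hk s t) (hasVertex_upper_pt_iff hg hk s' t')
    rw [faceFactor_inr, faceFactor_inr]
    simp only [key _ _ (Face.hasDart_bottom _) (Face.hasDart_bottom _)
        (fun hg hk => pts hg hk 0 0 1 0),
      key _ _ (Face.hasDart_right _) (Face.hasDart_right _) (fun hg hk => pts hg hk 1 0 1 1),
      key _ _ (Face.hasDart_top _) (Face.hasDart_top _) (fun hg hk => pts hg hk 1 1 0 1),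
      key _ _ (Face.hasDart_left _) (Face.hasDart_left _) (fun hg hk => pts hg hk 0 1 0 0)]
    rfl
  -- The two signs are extracted one at a time; the one on the upper face waits for `step'`.
  have step : tensor (fun q => faceFactor o (c.lower k) q * faceFactor o (c.upper k) q) =
      -tensor fun q : Qubit o => if q = .inr ⟨c.upper k, hu⟩ then -1 else 1 := by
    refine tensor_eq_neg (.inr ⟨c.lower k, hl⟩) ?_ ?_
    · rw [faceFactor_self hl, huu, if_neg hdiff.symm, mul_one]
    · rintro (u | g) hg
      · rw [faceFactor_inl hl, faceFactor_inl hu, if_neg (by simp), mul_one]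
      · by_cases hgu : g.1 = c.upper k
        · have : g = ⟨c.upper k, hu⟩ := Subtype.ext hgu
          rw [this, hll, faceFactor_self hu, if_pos rfl, one_mul]
        · have hgl : g.1 ≠ c.lower k := fun e => hg (congrArg Sum.inr (Subtype.ext e))
          rw [side g hgl hgu, faceFactor_mul_self hgl, if_neg]
          exact fun e => hgu (congrArg Subtype.val (Sum.inr.inj e))
  have step' : tensor (fun q : Qubit o => if q = .inr ⟨c.upper k, hu⟩ then -1 else 1) =
      -tensor fun _ : Qubit o => (1 : Matrix (Fin 2) (Fin 2) ℂ) :=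
    tensor_eq_neg (.inr ⟨c.upper k, hu⟩) (if_pos rfl) fun r hr => if_neg hr
  rw [step, step', neg_neg, tensor_one]

end Operators

end Cubic

/-! ### The kernel of the cubic encoding on cycles -/

namespace Cubic

open Pauli MGroup

variable {n : Fin 3 → ℕ}

/-- Both ends of the edge are vertices of the cell. -/
def Cell.HasDart (c : Cell n) (d : (graph n).Dart) : Prop :=
  Cell.HasVertex c d.fst ∧ Cell.HasVertex c d.snd

theorem Face.HasDart.cell {f : Face n} {c : Cell n} (h : f.IsFaceOf c) {d : (graph n).Dart}
    (hd : f.HasDart d) : Cell.HasDart c d :=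
  ⟨((Face.hasVertex_iff_of_isFaceOf h).1 hd.1).1, ((Face.hasVertex_iff_of_isFaceOf h).1 hd.2).1⟩

theorem pairCycle_mem_cycles (c : Cell n) (k : Fin 3) : pairCycle c k ∈ cycles (graph n) :=
  mul_mem (faceCycle_mem_cycles _) (faceCycle_mem_cycles _)

open Classical in
-- An edge of the cell with direction other than `j` lies in exactly one of the two opposite faces,
-- and an edge in direction `j` in neither.
theorem edgeContent_pairCycle (c : Cell n) (j : Fin 3) {k : Fin 3} {d : (graph n).Dart}
    (hd : Along k d.fst d.snd) :
    (pairCycle c j).edgeContent d = if Cell.HasDart c d ∧ k ≠ j then 1 else 0 := by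
  have fl : (c.lower j).IsFaceOf c := ⟨j, .inl rfl⟩
  have fu : (c.upper j).IsFaceOf c := ⟨j, .inr rfl⟩
  rw [pairCycle, edgeContent_mul, edgeContent_faceCycle, edgeContent_faceCycle]
  by_cases h : Cell.HasDart c d ∧ k ≠ j
  · obtain ⟨⟨h₁, h₂⟩, hkj⟩ := h
    have e := hd.2 j hkj.symm
    have lv : ((c.lower j).corner (c.lower j).axis : ℕ) = c j := rfl
    have uv : ((c.upper j).corner (c.upper j).axis : ℕ) = c j + 1 := by simp [Cell.upper]
    have hl (w : Vertex n) (hw : Cell.HasVertex c w) (h' : (w j : ℕ) = c j) :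
        (c.lower j).HasVertex w := (Face.hasVertex_iff_of_isFaceOf fl).2 ⟨hw, h'⟩
    have hu (w : Vertex n) (hw : Cell.HasVertex c w) (h' : (w j : ℕ) = c j + 1) :
        (c.upper j).HasVertex w :=
      (Face.hasVertex_iff_of_isFaceOf fu).2 ⟨hw, Eq.trans h' uv.symm⟩
    rcases h₁ j with h₃ | h₃
    · have : (c.lower j).HasDart d := ⟨hl _ h₁ h₃, hl _ h₂ (e ▸ h₃)⟩
      rw [if_pos this, if_neg fun h' => not_hasVertex_upper_of_lower this.1 h'.1, add_zero,
        if_pos ⟨⟨h₁, h₂⟩, hkj⟩]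
    · have : (c.upper j).HasDart d := ⟨hu _ h₁ h₃, hu _ h₂ (e ▸ h₃)⟩
      rw [if_pos this, if_neg fun h' => not_hasVertex_upper_of_lower h'.1 this.1, zero_add,
        if_pos ⟨⟨h₁, h₂⟩, hkj⟩]
  · rw [if_neg h, if_neg fun h' => h ⟨h'.cell fl, Face.ne_axis h'.1 h'.2 hd⟩,
      if_neg fun h' => h ⟨h'.cell fu, Face.ne_axis h'.1 h'.2 hd⟩, add_zero]

/-- Parallel sides of a face differ only in the coordinate `l`. The darts may be mutually reversed,
hence the equality of undirected edges. -/
theorem edge_eq_of_parallel {f : Face n} {k l : Fin 3} {d d' : (graph n).Dart}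
    (h : f.HasDart d) (h' : f.HasDart d') (hk : Along k d.fst d.snd)
    (hk' : Along k d'.fst d'.snd) (hl : ∀ j, j = k ∨ j = l ∨ j = f.axis)
    (hlk : l ≠ k) (hdd : (d.fst l : ℕ) = d'.fst l) : d.edge = d'.edge := by
  have hax := Face.ne_axis h.1 h.2 hk
  have key (x y : Vertex n) (hx : f.HasVertex x) (hy : f.HasVertex y) (hxk : (x k : ℕ) = y k)
      (hxl : (x l : ℕ) = y l) : x = y := by
    refine vertex_ext fun j => ?_
    rcases hl j with rfl | rfl | rfl
    · exact hxk
    · exact hxl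
    · rw [hx.axis_val, hy.axis_val]
  have a₁ := h.1.2 k hax
  have a₂ := h.2.2 k hax
  have a₃ := h'.1.2 k hax
  have a₄ := h'.2.2 k hax
  have a₅ := hk.1
  have a₆ := hk'.1
  have b₁ := hk.2 l hlk
  have b₂ := hk'.2 l hlk
  rw [SimpleGraph.dart_edge_eq_iff]
  by_cases e : (d.fst k : ℕ) = d'.fst k
  · left
    exact SimpleGraph.Dart.ext _ _ (Prod.ext (key _ _ h.1 h'.1 e hdd)
      (key _ _ h.2 h'.2 (by omega) (by omega)))
  · right
    have e₁ : d.fst = d'.snd := key _ _ h.1 h'.2 (by omega) (by omega)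
    have e₂ : d.snd = d'.fst := key _ _ h.2 h'.1 (by omega) (by omega)
    exact SimpleGraph.Dart.ext _ _ (Prod.ext e₁ e₂)

section Kernel

variable {o : Orientation n} {χ : EdgeChoice o} {σ : MGroup (graph n) →* Op o}

/-- This is the faithfulness on phases required by `content_injOn_ker`. -/
theorem IsEncoding.phase_pow (hσ : IsEncoding o χ σ) (k : ℕ) (hk : k < 4)
    (h : σ (I (graph n)) ^ k = 1) : k = 0 := by
  rw [hσ.phase, smul_pow, one_pow] at h
  have h₁ : Complex.I ^ k = 1 := by
    have := congrFun (congrFun h 0) 0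
    simpa using this
  interval_cases k
  · rfl
  · have := congrArg Complex.re h₁
    simp at this
  · rw [Complex.I_sq] at h₁
    norm_num at h₁
  · rw [Complex.I_pow_three] at h₁
    have := congrArg Complex.re h₁
    simp at this

/-- If an edge of an element of the kernel anticommutes with a Pauli operator on one qubit, so does
another one. -/
theorem IsEncoding.exists_edge (hσ : IsEncoding o χ σ) {m : MGroup (graph n)}
    (hm : m ∈ cycleKernel (graph n) σ) (q : Qubit o) (k : Fin 3) {d : (graph n).Dart}
    (hd : Anti (edgeLabel o d q) (some k)) (hmd : m.edgeContent d = 1) :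
    ∃ d', d'.edge ≠ d.edge ∧ Anti (edgeLabel o d' q) (some k) ∧ m.edgeContent d' = 1 := by
  let t : Qubit o → Option (Fin 3) := fun r => if r = q then some k else none
  have tq : t q = some k := if_pos rfl
  have comm (b : Qubit o → Option (Fin 3)) (h : ¬ Anti (b q) (some k)) :
      word b * word t = word t * word b := by
    refine word_mul_word_of_not_anti fun r hr => ?_
    by_cases hrq : r = q
    · subst hrq; exact h (tq ▸ hr)
    · exact hr.2.1 (if_neg hrq)
  have anti (b : Qubit o → Option (Fin 3)) (h : Anti (b q) (some k)) :
      word b * word t = -(word t * word b) :=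
    word_mul_word_of_anti q (tq ▸ h) fun r hr h' => h'.2.1 (if_neg hr)
  refine exists_edge_of_test σ (word t) (word_ne_neg_word t)
    (fun x => Anti (vertexLabel o x q) (some k)) (fun d => Anti (edgeLabel o d q) (some k))
    (fun d d' h hd => edgeLabel_congr o h ▸ hd) ?_ (fun x => ?_) (fun d => ?_) hm hd hmd
  · rw [hσ.phase]; simp
  · rw [hσ.vert, vertexOp_eq]
    exact ⟨comm _, anti _⟩
  · rw [hσ.edge, edgeOp_eq, smul_mul_assoc, mul_smul_comm]
    exact ⟨fun h => by rw [comm _ h], fun h => by rw [anti _ h, smul_neg]⟩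

/-- Elements of the kernel contain both or none of two opposite sides of an odd face. -/
theorem IsEncoding.parallel_face (hσ : IsEncoding o χ σ) {m : MGroup (graph n)}
    (hm : m ∈ cycleKernel (graph n) σ) {f : Face n} (hf : IsOddFace o.pointsTo f) {k : Fin 3}
    {d d' : (graph n).Dart} (h : f.HasDart d) (h' : f.HasDart d') (hk : Along k d.fst d.snd)
    (hk' : Along k d'.fst d'.snd) (hmd : m.edgeContent d = 1) : m.edgeContent d' = 1 := by
  have hax := Face.ne_axis h.1 h.2 hk
  obtain ⟨l, hl, hlk, hj⟩ := Face.exists_other hax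
  have label : edgeLabel o d (.inr ⟨f, hf⟩) = some k := by
    rw [edgeLabel_inr, hk.dir_eq]; exact if_pos h
  -- Testing the face qubit with the Pauli matrix of the direction `l` detects precisely the two
  -- sides in direction `k`.
  obtain ⟨e, hed, ⟨he₁, he₂, he₃⟩, hme⟩ := hσ.exists_edge hm (.inr ⟨f, hf⟩) l (d := d)
    (by rw [label]; exact ⟨by simp, by simp, by simpa using hlk.symm⟩) hmd
  rw [edgeLabel_inr] at he₁ he₃
  have fe : f.HasDart e := of_not_not fun h => he₁ (if_neg h)
  replace he₃ : some (dir e.fst e.snd) ≠ some l := fun h => he₃ ((if_pos fe).trans h)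
  obtain ⟨i, hi⟩ := exists_along e.adj
  rw [hi.dir_eq] at he₃
  have hik : i = k := by
    rcases hj i with h | h | h
    · exact h
    · exact absurd (congrArg some h) he₃
    · exact absurd h (Face.ne_axis fe.1 fe.2 hi)
  subst hik
  by_cases e₁ : (d.fst l : ℕ) = d'.fst l
  · rw [← edgeContent_congr m (edge_eq_of_parallel h h' hk hk' hj hlk e₁), hmd]
  · have e₂ : (d.fst l : ℕ) ≠ e.fst l := fun e₂ =>
      hed (edge_eq_of_parallel h fe hk hi hj hlk e₂).symm
    have e₃ : (e.fst l : ℕ) = d'.fst l := by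
      have a₁ := h.1.2 l hl
      have a₂ := h'.1.2 l hl
      have a₃ := fe.1.2 l hl
      omega
    rw [← edgeContent_congr m (edge_eq_of_parallel fe h' hi hk' hj hlk e₃), hme]

theorem exists_face_through {c : Cell n} {w : Vertex n} (hw : Cell.HasVertex c w) (l : Fin 3) :
    ∃ f : Face n, f.IsFaceOf c ∧
      ∀ u, Cell.HasVertex c u → (u l : ℕ) = w l → f.HasVertex u := by
  have fl : (c.lower l).IsFaceOf c := ⟨l, .inl rfl⟩
  have fu : (c.upper l).IsFaceOf c := ⟨l, .inr rfl⟩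
  have uv : ((c.upper l).corner (c.upper l).axis : ℕ) = c l + 1 := by simp [Cell.upper]
  rcases hw l with h | h
  · exact ⟨_, fl, fun u hu hul => (Face.hasVertex_iff_of_isFaceOf fl).2 ⟨hu, hul.trans h⟩⟩
  · exact ⟨_, fu, fun u hu hul => (Face.hasVertex_iff_of_isFaceOf fu).2
      ⟨hu, (hul.trans h).trans uv.symm⟩⟩

/-- Elements of the kernel contain all or none of the parallel edges of an odd cell. -/
theorem IsEncoding.parallel_cell (hσ : IsEncoding o χ σ) {m : MGroup (graph n)}
    (hm : m ∈ cycleKernel (graph n) σ) {c : Cell n} (hc : IsOddCell o c) {k : Fin 3}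
    {d d' : (graph n).Dart} (h : Cell.HasDart c d) (h' : Cell.HasDart c d')
    (hk : Along k d.fst d.snd) (hk' : Along k d'.fst d'.snd) (hmd : m.edgeContent d = 1) :
    m.edgeContent d' = 1 := by
  obtain ⟨l, hlk⟩ := exists_ne k
  obtain ⟨i, hil, hik, hj⟩ := exists_third hlk
  -- The edge `u v` is parallel to `d` and `d'`, at the `l`-coordinate of `d` and the remaining
  -- coordinate of `d'`, so it shares a face of the cell with each of them.
  let u : Vertex n := Function.update d'.fst l (d.fst l)
  let v : Vertex n := Function.update d'.snd l (d.fst l)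
  have ul : u l = d.fst l := Function.update_self ..
  have vl : v l = d.fst l := Function.update_self ..
  have uj (j : Fin 3) (hj : j ≠ l) : u j = d'.fst j := Function.update_of_ne hj ..
  have vj (j : Fin 3) (hj : j ≠ l) : v j = d'.snd j := Function.update_of_ne hj ..
  have huv : Along k u v := by
    refine ⟨by rw [uj k hlk.symm, vj k hlk.symm]; exact hk'.1, fun j hjk => ?_⟩
    by_cases hjl : j = l
    · rw [hjl, ul, vl]
    · rw [uj j hjl, vj j hjl]; exact hk'.2 j hjk
  have cu : Cell.HasVertex c u := fun j => by
    by_cases hjl : j = l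
    · rw [hjl, ul]; exact h.1 l
    · rw [uj j hjl]; exact h'.1 j
  have cv : Cell.HasVertex c v := fun j => by
    by_cases hjl : j = l
    · rw [hjl, vl]; exact h.1 l
    · rw [vj j hjl]; exact h'.2 j
  let e : (graph n).Dart := ⟨(u, v), huv.adj⟩
  obtain ⟨f, fc, hf⟩ := exists_face_through h.1 l
  obtain ⟨g, gc, hg⟩ := exists_face_through h'.1 i
  have he : m.edgeContent e = 1 := hσ.parallel_face hm (hc f fc) (d := d) (d' := e)
    ⟨hf _ h.1 rfl, hf _ h.2 (hk.2 l hlk).symm⟩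
    ⟨hf _ cu (congrArg Fin.val ul), hf _ cv (congrArg Fin.val vl)⟩ hk huv hmd
  exact hσ.parallel_face hm (hc g gc) (d := e) (d' := d')
    ⟨hg _ cu (congrArg Fin.val (uj i hil)),
      hg _ cv ((congrArg Fin.val (vj i hil)).trans (hk'.2 i hik).symm)⟩
    ⟨hg _ h'.1 rfl, hg _ h'.2 (hk'.2 i hik).symm⟩ huv hk' he

/-- Every edge of an element of the kernel meets another one in an odd face. -/
theorem IsEncoding.exists_odd_face (hn : ∀ k, 0 < n k) (hσ : IsEncoding o χ σ)
    {m : MGroup (graph n)} (hm : m ∈ cycleKernel (graph n) σ) {d : (graph n).Dart} {k : Fin 3}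
    (hk : Along k d.fst d.snd) (hmd : m.edgeContent d = 1) :
    ∃ (f : Face n) (l : Fin 3) (e : (graph n).Dart), IsOddFace o.pointsTo f ∧ f.HasDart d ∧
      f.HasDart e ∧ Along l e.fst e.snd ∧ k ≠ l ∧ m.edgeContent e = 1 := by
  -- Edges act on a vertex qubit by `X` or `Y`. Testing with the one that `d` does not use detects
  -- the edges with the same matrix as `d`: those that leave `d.fst` if `d` does, and enter it
  -- otherwise. Such an edge is not collinear with `d`, and the face spanned is odd.
  obtain ⟨e, hed, hanti, hme⟩ := hσ.exists_edge hm (.inl d.fst)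
    (if o.pointsTo d.fst d.snd then 1 else 0) (d := d)
    (by
      rw [edgeLabel_fst]
      refine ⟨by simp, by simp, ?_⟩
      split_ifs <;> simp) hmd
  wlog hfst : e.fst = d.fst generalizing e
  · have hsnd : e.snd = d.fst := by
      by_contra hsnd
      exact hanti.1 (edgeLabel_inl_of_ne o (Ne.symm hfst) (Ne.symm hsnd))
    exact this e.symm (by rwa [SimpleGraph.Dart.edge_symm]) (by rwa [edgeLabel_symm])
      (by rwa [edgeContent_congr m (SimpleGraph.Dart.edge_symm e)]) hsnd
  have hp : o.pointsTo e.fst e.snd = o.pointsTo d.fst d.snd := by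
    rw [← hfst, edgeLabel_fst, hfst] at hanti
    obtain ⟨-, -, hne⟩ := hanti
    rw [hfst]
    cases h₁ : o.pointsTo d.fst e.snd <;> cases h₂ : o.pointsTo d.fst d.snd <;>
      simp [h₁, h₂] at hne ⊢
  have hne : d.snd ≠ e.snd := fun h =>
    hed (congrArg SimpleGraph.Dart.edge (SimpleGraph.Dart.ext _ _ (Prod.ext hfst h.symm)))
  obtain ⟨l, hl⟩ := exists_along e.adj
  have hl' : Along l d.fst e.snd := hfst ▸ hl
  have hkl : k ≠ l := by
    rintro rfl
    have h₁ := o.pointsTo_collinear hn hk.symm hl' hne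
    rw [o.pointsTo_symm _ _ d.adj, ← hp, hfst] at h₁
    cases h : o.pointsTo d.fst e.snd <;> simp [h] at h₁
  obtain ⟨f, f₁, f₂, f₃⟩ := Face.exists_hasVertex hk.symm hl' hkl
  refine ⟨f, l, e, ?_, ⟨f₂, f₁⟩, ⟨hfst ▸ f₂, f₃⟩, hl, hkl, hme⟩
  rw [o.odd_iff hk.symm.adj hl'.adj hne f₁ f₂ f₃, ← hp, hfst]

/-! ### Generation of the kernel by basic cycles -/

/-- The cycle around an isolated odd face, or around a pair of opposite faces of an odd cell. -/
def IsBasicCycle (o : Orientation n) (g : MGroup (graph n)) : Prop :=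
  (∃ f, IsIsolatedOddFace o f ∧ g = faceCycle f) ∨ ∃ c k, IsOddCell o c ∧ g = pairCycle c k

theorem IsBasicCycle.mem_cycleKernel (hσ : IsEncoding o χ σ) {a : Fin 3 → ℕ}
    (ha : IsParity o a) {g : MGroup (graph n)} (hg : IsBasicCycle o g) :
    g ∈ cycleKernel (graph n) σ := by
  rcases hg with ⟨f, hf, rfl⟩ | ⟨c, k, hc, rfl⟩
  · exact ⟨faceCycle_mem_cycles f, map_faceCycle_of_isolated χ hσ ha hf⟩
  · exact ⟨pairCycle_mem_cycles c k, map_pairCycle χ hσ ha hc k⟩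

/-- Every edge of an element of the kernel lies on a basic cycle all of whose edges occur in that
element. -/
theorem IsEncoding.exists_basicCycle (hn : ∀ k, 0 < n k) (hσ : IsEncoding o χ σ)
    {a : Fin 3 → ℕ} (ha : IsParity o a) {m : MGroup (graph n)}
    (hm : m ∈ cycleKernel (graph n) σ) {d : (graph n).Dart} (hmd : m.edgeContent d = 1) :
    ∃ g, IsBasicCycle o g ∧ g.edgeContent d = 1 ∧
      ∀ d', g.edgeContent d' = 1 → m.edgeContent d' = 1 := by
  classical
  obtain ⟨k, hk⟩ := exists_along d.adj
  obtain ⟨f, l, e, hf, fd, fe, hl, hkl, hme⟩ := hσ.exists_odd_face hn hm hk hmd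
  have hfk := Face.ne_axis fd.1 fd.2 hk
  have hfl := Face.ne_axis fe.1 fe.2 hl
  have dirs (j : Fin 3) (hj : j ≠ f.axis) : j = k ∨ j = l := by
    obtain ⟨i, h₁, h₂, h₃⟩ := exists_third hkl
    rcases h₃ j with h | h | h
    · exact .inl h
    · exact .inr h
    · exact absurd (h.trans (Face.axis_eq hfk hfl hkl h₁ h₂).symm) hj
  -- Both in-plane directions of `f` are represented in `m`, by `d` and `e`; each spreads to its
  -- parallels in the face or in the cell.
  rcases exists_oddCell_or_isolated ha hf with hiso | ⟨c, hc, hfc⟩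
  · refine ⟨faceCycle f, .inl ⟨f, hiso, rfl⟩, by rw [edgeContent_faceCycle, if_pos fd],
      fun d' hd' => ?_⟩
    rw [edgeContent_faceCycle] at hd'
    have fd' : f.HasDart d' := by
      by_contra h
      rw [if_neg h] at hd'
      exact zero_ne_one hd'
    obtain ⟨j, hj⟩ := exists_along d'.adj
    rcases dirs j (Face.ne_axis fd'.1 fd'.2 hj) with rfl | rfl
    · exact hσ.parallel_face hm hf fd fd' hk hj hmd
    · exact hσ.parallel_face hm hf fe fd' hl hj hme
  · refine ⟨pairCycle c f.axis, .inr ⟨c, f.axis, hc, rfl⟩,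
      by rw [edgeContent_pairCycle c _ hk, if_pos ⟨fd.cell hfc, hfk⟩], fun d' hd' => ?_⟩
    obtain ⟨j, hj⟩ := exists_along d'.adj
    rw [edgeContent_pairCycle c _ hj] at hd'
    have cd' : Cell.HasDart c d' ∧ j ≠ f.axis := by
      by_contra h
      rw [if_neg h] at hd'
      exact zero_ne_one hd'
    rcases dirs j cd'.2 with rfl | rfl
    · exact hσ.parallel_cell hm hc (fd.cell hfc) cd'.1 hk hj hmd
    · exact hσ.parallel_cell hm hc (fe.cell hfc) cd'.1 hl hj hme

theorem content_eq_of_edgeContent_eq {a b : MGroup (graph n)} (ha : a ∈ cycles (graph n))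
    (hb : b ∈ cycles (graph n)) (h : ∀ d, a.edgeContent d = b.edgeContent d) :
    a.content = b.content := by
  funext x
  rcases x with v | ⟨e, he⟩
  · rw [content_inl_of_mem_cycles ha, content_inl_of_mem_cycles hb]
  · induction e with
    | h v w => exact h ⟨(v, w), he⟩

/-- The basic cycles generate the kernel. -/
theorem IsEncoding.closure_basicCycle (hn : ∀ k, 0 < n k) (hσ : IsEncoding o χ σ)
    {a : Fin 3 → ℕ} (ha : IsParity o a) :
    Subgroup.closure {g | IsBasicCycle o g} = cycleKernel (graph n) σ := by
  classical
  refine le_antisymm ((Subgroup.closure_le _).2 fun g hg => hg.mem_cycleKernel hσ ha) ?_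
  intro m hm
  have z2 (x : ZMod 2) : x = 0 ∨ x = 1 := by revert x; decide
  have z11 : (1 + 1 : ZMod 2) = 0 := by decide
  -- Multiplying by a basic cycle contained in `m` deletes its edges modulo 2 and adds none, so the
  -- number of darts present decreases.
  induction hN : (Finset.univ.filter fun d => m.edgeContent d = 1).card
    using Nat.strong_induction_on generalizing m with
  | _ N ih =>
  by_cases hne : ∃ d, m.edgeContent d = 1
  · obtain ⟨d, hd⟩ := hne
    obtain ⟨g, hg, hgd, hgm⟩ := hσ.exists_basicCycle hn ha hm hd
    have hmem : m * g ∈ Subgroup.closure {g | IsBasicCycle o g} := by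
      refine ih _ ?_ (mul_mem hm (hg.mem_cycleKernel hσ ha)) rfl
      rw [← hN]
      refine Finset.card_lt_card (Finset.ssubset_iff_of_subset (fun d' hd' => ?_) |>.2
        ⟨d, by simpa using hd, by simp [edgeContent_mul, hd, hgd, z11]⟩)
      simp only [Finset.mem_filter, Finset.mem_univ, true_and, edgeContent_mul] at hd' ⊢
      rcases z2 (g.edgeContent d') with h | h
      · rwa [h, add_zero] at hd'
      · exact hgm d' h
    have := mul_mem hmem (inv_mem (Subgroup.subset_closure hg))
    rwa [mul_inv_cancel_right] at this
  · push Not at hne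
    have h1 : m = 1 := content_injOn_ker hσ.phase_pow hm.2 (map_one σ)
      (content_eq_of_edgeContent_eq hm.1 (one_mem _) fun d => by
        rw [(z2 _).resolve_right (hne d)]
        simp [edgeContent, content_one])
    rw [h1]
    exact one_mem _

/-- The product of the three pairs of opposite faces of an odd cell is trivial. -/
theorem IsEncoding.pairCycle_eq (hσ : IsEncoding o χ σ) {a : Fin 3 → ℕ} (ha : IsParity o a)
    {c : Cell n} (hc : IsOddCell o c) {p q r : Fin 3} (hpq : p ≠ q) (hrp : r ≠ p)
    (hrq : r ≠ q) : pairCycle c r = pairCycle c p * pairCycle c q := by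
  classical
  refine content_injOn_ker hσ.phase_pow (map_pairCycle χ hσ ha hc r)
    (by rw [map_mul, map_pairCycle χ hσ ha hc p, map_pairCycle χ hσ ha hc q, one_mul])
    (content_eq_of_edgeContent_eq (pairCycle_mem_cycles c r)
      (mul_mem (pairCycle_mem_cycles c p) (pairCycle_mem_cycles c q)) fun d => ?_)
  have z11 : (1 + 1 : ZMod 2) = 0 := by decide
  obtain ⟨k, hk⟩ := exists_along d.adj
  rw [edgeContent_mul, edgeContent_pairCycle c r hk, edgeContent_pairCycle c p hk,
    edgeContent_pairCycle c q hk]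
  -- An edge of the cell occurs in the two pairs whose normal is not its direction, hence an even
  -- number of times in all three together.
  by_cases h : Cell.HasDart c d
  · have hall : k = p ∨ k = q ∨ k = r := by
      clear hk
      revert p q r k; decide
    rcases hall with rfl | rfl | rfl
    · simp [h, hpq, hrp.symm]
    · simp [h, hpq.symm, hrq.symm]
    · simp [h, hrp, hrq, z11]
  · simp [h]

/-- Compared with all basic cycles only the third pair of each odd cell is missing, and it is the
product of the two chosen ones. -/
theorem IsEncoding.closure_kernelGen (hn : ∀ k, 0 < n k) (hσ : IsEncoding o χ σ)
    {a : Fin 3 → ℕ} (ha : IsParity o a) {p q : OddCell o → Fin 3} (hpq : ∀ c, p c ≠ q c) :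
    Subgroup.closure (Set.range (kernelGen o p q)) = cycleKernel (graph n) σ := by
  rw [← hσ.closure_basicCycle hn ha]
  refine le_antisymm (Subgroup.closure_mono ?_) ((Subgroup.closure_le _).2 ?_)
  · rintro _ ⟨f | c | c, rfl⟩
    · exact .inl ⟨f.1, f.2, rfl⟩
    · exact .inr ⟨c.1, p c, c.2, rfl⟩
    · exact .inr ⟨c.1, q c, c.2, rfl⟩
  · rintro g (⟨f, hf, rfl⟩ | ⟨c, r, hc, rfl⟩)
    · exact Subgroup.subset_closure ⟨.inl ⟨f, hf⟩, rfl⟩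
    · have hp : pairCycle c (p ⟨c, hc⟩) ∈ Subgroup.closure (Set.range (kernelGen o p q)) :=
        Subgroup.subset_closure ⟨.inr (.inl ⟨c, hc⟩), rfl⟩
      have hq : pairCycle c (q ⟨c, hc⟩) ∈ Subgroup.closure (Set.range (kernelGen o p q)) :=
        Subgroup.subset_closure ⟨.inr (.inr ⟨c, hc⟩), rfl⟩
      by_cases h₁ : r = p ⟨c, hc⟩
      · rw [h₁]; exact hp
      by_cases h₂ : r = q ⟨c, hc⟩
      · rw [h₂]; exact hq
      rw [hσ.pairCycle_eq ha hc (hpq ⟨c, hc⟩) h₁ h₂]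
      exact mul_mem hp hq

end Kernel

/-! ### Independence of the generators -/

/-- The number of occurrences of an edge, as a homomorphism. -/
noncomputable def edgeHom (d : (graph n).Dart) : MGroup (graph n) →* Multiplicative (ZMod 2) where
  toFun m := .ofAdd (m.edgeContent d)
  map_one' := by simp [edgeContent, content_one]
  map_mul' a b := by rw [edgeContent_mul]; rfl

/-- An edge of a cell in the given direction. -/
def Cell.dart (c : Cell n) (k : Fin 3) : (graph n).Dart := (c.lower (k + 2)).bottom

theorem Cell.along_dart (c : Cell n) (k : Fin 3) :
    Along k (Cell.dart c k).fst (Cell.dart c k).snd := by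
  have h := (c.lower (k + 2)).along_pt_left 0
  -- The bottom side of a face runs in the direction after its normal, and k + 2 + 1 = k in `Fin 3`.
  have e : (c.lower (k + 2)).axis + 1 = k := by
    change k + 2 + 1 = k
    clear h
    revert k; decide
  rw [e] at h
  exact h

theorem Cell.hasDart_dart (c : Cell n) (k : Fin 3) : Cell.HasDart c (Cell.dart c k) :=
  (Face.hasDart_bottom _).cell ⟨k + 2, .inl rfl⟩

/-- For each generator of the kernel an edge that detects it. -/
def dualDart (o : Orientation n) (p q : OddCell o → Fin 3) :
    IsolatedOddFace o ⊕ (OddCell o ⊕ OddCell o) → (graph n).Dart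
  | .inl f => f.1.bottom
  -- The roles of `p` and `q` are swapped: an edge in direction `q c` lies in the pair with normal
  -- `p c` and misses the one with normal `q c`.
  | .inr (.inl c) => Cell.dart c.1 (q c)
  | .inr (.inr c) => Cell.dart c.1 (p c)

/-- Isolated odd faces and odd cells have no edges in common with each other or among themselves, so
only the two pairs of one cell could interfere, and the swapped directions separate them. -/
theorem edgeHom_dualDart {o : Orientation n} {a : Fin 3 → ℕ} (ha : IsParity o a)
    {p q : OddCell o → Fin 3} (hpq : ∀ c, p c ≠ q c)
    (i j : IsolatedOddFace o ⊕ (OddCell o ⊕ OddCell o)) :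
    edgeHom (dualDart o p q i) (kernelGen o p q j) = .ofAdd (if i = j then 1 else 0) := by
  classical
  refine congrArg Multiplicative.ofAdd ?_
  have face_cell (f : IsolatedOddFace o) (c : OddCell o) {d : (graph n).Dart}
      (hf : f.1.HasDart d) (hc : Cell.HasDart c.1 d) : False := by
    obtain ⟨k, hk⟩ := exists_along d.adj
    exact f.2.2.2 c.1 c.2 (isFaceOf_of_isOddCell ha c.2 f.2.1 hk hc.1 hc.2 hf.1 hf.2)
  have cell_cell (c c' : OddCell o) (k : Fin 3) (h : Cell.HasDart c'.1 (Cell.dart c.1 k)) :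
      c = c' := by
    have hface : (c.1.lower (k + 2)).IsFaceOf c.1 := ⟨k + 2, .inl rfl⟩
    have hd : (c.1.lower (k + 2)).HasDart (Cell.dart c.1 k) := Face.hasDart_bottom _
    exact Subtype.ext (oddCell_eq_of_isFaceOf ha c.2 c'.2 hface
      (isFaceOf_of_isOddCell ha c'.2 (c.2 _ hface) (Cell.along_dart c.1 k) h.1 h.2 hd.1 hd.2))
  have face_pair (f : IsolatedOddFace o) (c : OddCell o) (j : Fin 3) :
      (pairCycle c.1 j).edgeContent f.1.bottom = 0 := by
    rw [edgeContent_pairCycle c.1 j (f.1.along_pt_left 0)]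
    exact if_neg fun h => face_cell f c (Face.hasDart_bottom _) h.1
  have cell_face (f : IsolatedOddFace o) (c : OddCell o) (k : Fin 3) :
      (faceCycle f.1).edgeContent (Cell.dart c.1 k) = 0 := by
    rw [edgeContent_faceCycle]
    exact if_neg fun h => face_cell f c h (Cell.hasDart_dart c.1 k)
  have cell_pair (c c' : OddCell o) (k j : Fin 3) :
      (pairCycle c'.1 j).edgeContent (Cell.dart c.1 k) = if c = c' ∧ k ≠ j then 1 else 0 := by
    rw [edgeContent_pairCycle c'.1 j (Cell.along_dart c.1 k)]
    refine if_congr (and_congr_left' ⟨cell_cell c c' k, ?_⟩) rfl rfl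
    rintro rfl
    exact Cell.hasDart_dart c.1 k
  rcases i with f | c | c <;> rcases j with f' | c' | c'
  · change (faceCycle f'.1).edgeContent f.1.bottom = _
    rw [edgeContent_faceCycle]
    refine if_congr ⟨fun h => ?_, fun h => ?_⟩ rfl rfl
    · exact congrArg _ (Subtype.ext (eq_of_isIsolatedOddFace ha f.2 f'.2.1 (f.1.along_pt_left 0)
        (Face.hasVertex_pt _ _ _) (Face.hasVertex_pt _ _ _) h.1 h.2)).symm
    · rw [Sum.inl.inj h]; exact Face.hasDart_bottom _
  · exact (face_pair f c' _).trans (if_neg (by simp)).symm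
  · exact (face_pair f c' _).trans (if_neg (by simp)).symm
  · exact (cell_face f' c _).trans (if_neg (by simp)).symm
  · refine (cell_pair c c' _ _).trans (if_congr ⟨fun h => by rw [h.1], fun h => ?_⟩ rfl rfl)
    obtain rfl := Sum.inl.inj (Sum.inr.inj h)
    exact ⟨rfl, (hpq c).symm⟩
  · refine (cell_pair c c' _ _).trans ((if_neg ?_).trans (if_neg (by simp)).symm)
    rintro ⟨rfl, h⟩
    exact h rfl
  · exact (cell_face f' c _).trans (if_neg (by simp)).symm
  · refine (cell_pair c c' _ _).trans ((if_neg ?_).trans (if_neg (by simp)).symm)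
    rintro ⟨rfl, h⟩
    exact h rfl
  · refine (cell_pair c c' _ _).trans (if_congr ⟨fun h => by rw [h.1], fun h => ?_⟩ rfl rfl)
    obtain rfl := Sum.inr.inj (Sum.inr.inj h)
    exact ⟨rfl, hpq c⟩

end Cubic

/-! ### The rank and the minimal generating sets -/

theorem mainTheorem2 (n : Fin 3 → ℕ) (hn : ∀ k, 0 < n k) (o : Cubic.Orientation n)
    (χ : Cubic.EdgeChoice o) :
    ∃ σ : MGroup (Cubic.graph n) →* Cubic.Op o, Cubic.IsEncoding o χ σ ∧
      (∃ _ : Group.FG (MGroup.cycleKernel (Cubic.graph n) σ),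
        Group.rank (MGroup.cycleKernel (Cubic.graph n) σ) =
          Fintype.card (Cubic.IsolatedOddFace o) + 2 * Fintype.card (Cubic.OddCell o)) ∧
      ∀ p q : Cubic.OddCell o → Fin 3, (∀ c, p c ≠ q c) →
        Subgroup.closure (Set.range (Cubic.kernelGen o p q)) =
            MGroup.cycleKernel (Cubic.graph n) σ ∧
          Function.Injective (Cubic.kernelGen o p q) ∧
          ∀ i, Cubic.kernelGen o p q i ∉
            Subgroup.closure (Cubic.kernelGen o p q '' {i}ᶜ) := by
  obtain ⟨a, ha⟩ := Cubic.exists_isParity hn o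
  obtain ⟨σ, hσ⟩ := Cubic.exists_encoding o χ hn
  refine ⟨σ, hσ, ?_, fun p q hpq => ?_⟩
  -- For the rank any one choice of pairs will do; here the normals are 0 and 1 in every odd cell.
  · have hpq : ∀ _ : Cubic.OddCell o, (0 : Fin 3) ≠ 1 := fun _ => by decide
    obtain ⟨hfg, hrank⟩ := Subgroup.rank_eq_card_of_dual (hσ.closure_kernelGen hn ha hpq)
      (fun i => Cubic.edgeHom (Cubic.dualDart o _ _ i)) (Cubic.edgeHom_dualDart ha hpq)
    refine ⟨hfg, hrank.trans ?_⟩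
    rw [Fintype.card_sum, Fintype.card_sum, two_mul]
  · have hnot := Subgroup.notMem_closure_image_compl_of_dual
      (fun i => Cubic.edgeHom (Cubic.dualDart o p q i)) (Cubic.edgeHom_dualDart ha hpq)
    exact ⟨hσ.closure_kernelGen hn ha hpq, Subgroup.injective_of_notMem_closure hnot, hnot⟩
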